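/- For positive integers $n,m$ and $0\le p\le 1$, let $G(n,m;p)$ be the random intersection graph on the vertex set $\{1,\dots,n\}$ defined as follows: choose independent random subsets $L_1,\dots,L_n$ of $\{1,\dots,m\}$, where each $L_i$ contains each element of $\{1,\dots,m\}$ independently with probability $p$, and join two distinct vertices $i,j$ by an edge if and only if $L_i\cap L_j\neq\emptyset$. Let $G(n,q)$ be the binomial random graph on $\{1,\dots,n\}$, in which every pair of distinct vertices is joined by an edge independently with probability $q$. For random graphs $X,Y$ on $\{1,\dots,n\}$ let $\mathrm{TV}(X,Y)=\frac12\sum_{G}\bigl|\Pr[X=G]-\Pr[Y=G]\bigr|$, where the sum is over all graphs $G$ on $\{1,\dots,n\}$. Theorem. Let $m=m(n)$ be a sequence of positive integers such that $m(n)/n^4\to\infty$ as $n\to\infty$, let $p=p(n)$ be an arbitrary sequence with $0\le p(n)\le 1$, and put $\hat p=\hat p(n)=1-(1-p^2)^m$. Then $$\mathrm{TV}\bigl(G(n,m;p),\,G(n,\hat p)\bigr)\longrightarrow 0\qquad\text{as } n\to\infty .$$ -/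

import Mathlib

open MeasureTheory ProbabilityTheory Filter Topology
open scoped unitInterval

/-- The intersection graph on `V` generated by the sets `L i`, `i ∈ V`: two distinct vertices are
adjacent if and only if their sets have a nonempty intersection. -/
def intersectionGraph {V M : Type*} (L : V → Set M) : SimpleGraph V where
  Adj i j := i ≠ j ∧ (L i ∩ L j).Nonempty
  symm := ⟨fun i j h => ⟨h.1.symm, by rw [Set.inter_comm]; exact h.2⟩⟩
  loopless := ⟨fun _ h => h.1 rfl⟩

theorem measurable_intersectionGraph (n m : ℕ) :
    Measurable (intersectionGraph : (Fin n → Set (Fin m)) → SimpleGraph (Fin n)) :=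
  measurable_of_countable _

/-- The joint law of `n` independent random subsets `L i` of `Fin m`, each of which contains every
element of `Fin m` with probability `p`, independently of all other elements. -/
noncomputable def randomSets (n m : ℕ) (p : I) : Measure (Fin n → Set (Fin m)) :=
  Measure.pi fun _ : Fin n => setBernoulli (Set.univ : Set (Fin m)) p

instance randomSets_isProbabilityMeasure (n m : ℕ) (p : I) :
    IsProbabilityMeasure (randomSets n m p) := by
  unfold randomSets
  infer_instance

/-- The law of the random intersection graph `G(n,m;p)`. -/
noncomputable def randomIntersectionGraph (n m : ℕ) (p : I) : Measure (SimpleGraph (Fin n)) :=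
  (randomSets n m p).map intersectionGraph

instance randomIntersectionGraph_isProbabilityMeasure (n m : ℕ) (p : I) :
    IsProbabilityMeasure (randomIntersectionGraph n m p) :=
  Measure.isProbabilityMeasure_map (measurable_intersectionGraph n m).aemeasurable

/-- The edge probability `1 - (1 - p ^ 2) ^ m`, as an element of the unit interval. -/
noncomputable def edgeProb (m : ℕ) (p : I) : I :=
  ⟨1 - (1 - (p : ℝ) ^ 2) ^ m, by
    have h0 : 0 ≤ 1 - (p : ℝ) ^ 2 := by nlinarith [p.2.1, p.2.2]
    have h1 : 1 - (p : ℝ) ^ 2 ≤ 1 := by nlinarith [p.2.1, p.2.2]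
    exact ⟨by linarith [pow_le_one₀ (n := m) h0 h1], by linarith [pow_nonneg h0 m]⟩⟩

/-- The total variation distance between two laws on a finite type:
half the sum of `|μ {a} - ν {a}|` over all values `a`. -/
noncomputable def tvDist {α : Type*} [Fintype α] [MeasurableSpace α] (μ ν : Measure α) : ℝ :=
  (1 / 2) * ∑ a : α, |μ.real {a} - ν.real {a}|

/-- A weak form of Pinsker's inequality for weights on a finite set. -/
theorem sum_abs_sub_le_two_mul_sqrt_kl {α : Type*} (s : Finset α) (P Q : α → ℝ)
    (hP : ∀ a ∈ s, 0 ≤ P a) (hQ : ∀ a ∈ s, 0 < Q a)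
    (hP1 : ∑ a ∈ s, P a = 1) (hQ1 : ∑ a ∈ s, Q a = 1) :
    ∑ a ∈ s, |P a - Q a| ≤ 2 * √(∑ a ∈ s, P a * Real.log (P a / Q a)) := by
  have hterm : ∀ a ∈ s, (√(P a) - √(Q a)) ^ 2 ≤ P a * Real.log (P a / Q a) - P a + Q a := by
    intro a ha
    rcases (hP a ha).eq_or_lt with h0 | h0
    · rw [← h0]; simp [Real.sq_sqrt (hQ a ha).le]
    · have hx : 0 < √(P a) := Real.sqrt_pos.2 h0
      have hy : 0 < √(Q a) := Real.sqrt_pos.2 (hQ a ha)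
      have hx2 : √(P a) ^ 2 = P a := Real.sq_sqrt h0.le
      have hy2 : √(Q a) ^ 2 = Q a := Real.sq_sqrt (hQ a ha).le
      have hl := Real.one_sub_inv_le_log_of_pos (div_pos hx hy)
      have e : Real.log (P a / Q a) = 2 * Real.log (√(P a) / √(Q a)) := by
        rw [← hx2, ← hy2, ← div_pow, Real.log_pow]; simp [Real.sqrt_sq hx.le, Real.sqrt_sq hy.le]
      have h2 : P a * (1 - (√(P a) / √(Q a))⁻¹) = P a - √(P a) * √(Q a) := by
        rw [← hx2]; simp only [Real.sqrt_sq hx.le]; field_simp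
      have h3 := mul_le_mul_of_nonneg_left hl h0.le
      rw [h2] at h3
      rw [e]; nlinarith
  have hH : ∑ a ∈ s, (√(P a) - √(Q a)) ^ 2 ≤ ∑ a ∈ s, P a * Real.log (P a / Q a) := by
    have := Finset.sum_le_sum hterm
    rw [Finset.sum_add_distrib, Finset.sum_sub_distrib, hP1, hQ1] at this
    linarith
  have h4 : ∑ a ∈ s, (√(P a) + √(Q a)) ^ 2 ≤ 4 := by
    have : ∀ a ∈ s, (√(P a) + √(Q a)) ^ 2 ≤ 2 * P a + 2 * Q a := by
      intro a ha
      nlinarith [sq_nonneg (√(P a) - √(Q a)), Real.sq_sqrt (hP a ha), Real.sq_sqrt (hQ a ha).le]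
    have := Finset.sum_le_sum this
    rw [Finset.sum_add_distrib, ← Finset.mul_sum, ← Finset.mul_sum, hP1, hQ1] at this
    linarith
  have hfac : ∀ a ∈ s, |P a - Q a| = |√(P a) - √(Q a)| * (√(P a) + √(Q a)) := by
    intro a ha
    rw [← abs_of_nonneg (add_nonneg (Real.sqrt_nonneg (P a)) (Real.sqrt_nonneg (Q a))), ← abs_mul]
    congr 1
    nlinarith [Real.sq_sqrt (hP a ha), Real.sq_sqrt (hQ a ha).le]
  have hcs := Finset.sum_mul_sq_le_sq_mul_sq s (fun a => |√(P a) - √(Q a)|)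
    (fun a => √(P a) + √(Q a))
  simp only [sq_abs] at hcs
  rw [← Finset.sum_congr rfl hfac] at hcs
  have hnn : 0 ≤ ∑ a ∈ s, P a * Real.log (P a / Q a) :=
    (Finset.sum_nonneg fun a _ => sq_nonneg _).trans hH
  refine abs_le_of_sq_le_sq' ?_ (by positivity) |>.2
  rw [mul_pow, Real.sq_sqrt hnn]
  have h5 : 0 ≤ ∑ a ∈ s, (√(P a) + √(Q a)) ^ 2 := Finset.sum_nonneg fun a _ => sq_nonneg _
  nlinarith

theorem kl_split_le (P₀ P₁ Q w : ℝ) (h0 : 0 ≤ P₀) (h1 : 0 ≤ P₁) (hQ : 0 < Q) (hw0 : 0 < w)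
    (hw1 : w < 1) :
    P₀ * Real.log (P₀ / (Q * w)) + P₁ * Real.log (P₁ / (Q * (1 - w))) ≤
      (P₀ + P₁) * Real.log ((P₀ + P₁) / Q) +
        (P₀ ^ 2 / (P₀ + P₁) - 2 * w * P₀ + w ^ 2 * (P₀ + P₁)) / (w * (1 - w)) := by
  have hv : 0 < 1 - w := by linarith
  have key : ∀ a T v : ℝ, 0 ≤ a → 0 < T → 0 < v →
      a * Real.log (a / (Q * v)) ≤ a * Real.log (T / Q) + (a ^ 2 / (T * v) - a) := by
    intro a T v ha hT hv
    rcases ha.eq_or_lt with rfl | ha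
    · simp
    · have e : Real.log (a / (Q * v)) = Real.log (T / Q) + Real.log (a / (T * v)) := by
        rw [← Real.log_mul (by positivity) (by positivity)]; congr 1; field_simp
      have hl := mul_le_mul_of_nonneg_left
        (Real.log_le_sub_one_of_pos (x := a / (T * v)) (by positivity)) ha.le
      have e2 : a * (a / (T * v) - 1) = a ^ 2 / (T * v) - a := by ring
      rw [e, mul_add]; linarith
  rcases (add_nonneg h0 h1).eq_or_lt with hT | hT
  · obtain rfl : P₀ = 0 := by linarith
    obtain rfl : P₁ = 0 := by linarith
    simp
  · have k0 := key P₀ _ w h0 hT hw0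
    have k1 := key P₁ _ (1 - w) h1 hT hv
    have e : (P₀ ^ 2 / (P₀ + P₁) - 2 * w * P₀ + w ^ 2 * (P₀ + P₁)) / (w * (1 - w)) =
        (P₀ ^ 2 / ((P₀ + P₁) * w) - P₀) + (P₁ ^ 2 / ((P₀ + P₁) * (1 - w)) - P₁) := by
      field_simp; ring
    rw [e]; linarith

section Reveal
open scoped Classical Finset

variable {Ω E : Type*} [Fintype Ω]

/-- The mass of the outcomes whose random set `X` agrees with `y` on `S`. -/
noncomputable def cellMass (P : Ω → ℝ) (X : Ω → Set E) (S y : Finset E) : ℝ :=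
  ∑ ω with ∀ f ∈ S, (f ∈ X ω ↔ f ∈ y), P ω

/-- The mass of the outcomes whose random set `X` agrees with `y` on `S` and does not contain
`e`. -/
noncomputable def cellMassNot (P : Ω → ℝ) (X : Ω → Set E) (S y : Finset E) (e : E) : ℝ :=
  ∑ ω with (∀ f ∈ S, (f ∈ X ω ↔ f ∈ y)) ∧ e ∉ X ω, P ω

theorem cellMass_insert (P : Ω → ℝ) (X : Ω → Set E) {S y : Finset E} {e : E} (he : e ∉ S)
    (hy : y ⊆ S) : cellMass P X (insert e S) y = cellMassNot P X S y e := by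
  unfold cellMass cellMassNot
  congr 1; ext ω
  have : e ∉ y := fun h => he (hy h)
  simp [this, and_comm]

theorem cellMassNot_add_cellMass_insert (P : Ω → ℝ) (X : Ω → Set E) {S y : Finset E} {e : E}
    (he : e ∉ S) :
    cellMassNot P X S y e + cellMass P X (insert e S) (insert e y) = cellMass P X S y := by
  unfold cellMass cellMassNot
  rw [← Finset.sum_filter_add_sum_filter_not
    (Finset.univ.filter fun ω => ∀ f ∈ S, (f ∈ X ω ↔ f ∈ y)) (fun ω => e ∉ X ω) P,
    Finset.filter_filter, Finset.filter_filter]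
  congr 2; ext ω
  simp only [Finset.mem_filter, Finset.mem_univ, true_and, Finset.forall_mem_insert,
    Finset.mem_insert_self, iff_true, not_not]
  rw [and_comm, and_congr_left_iff]
  intro _
  refine forall₂_congr fun f hf => ?_
  have : f ≠ e := fun h => he (h ▸ hf)
  simp [this]

theorem sum_cellMassNot (P : Ω → ℝ) (X : Ω → Set E) (S : Finset E) (e : E) :
    ∑ y ∈ S.powerset, cellMassNot P X S y e = ∑ ω with e ∉ X ω, P ω := by
  unfold cellMassNot
  rw [← Finset.sum_fiberwise_of_maps_to (s := Finset.univ.filter fun ω => e ∉ X ω)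
    (t := S.powerset) (g := fun ω => S.filter fun f => f ∈ X ω) (by intro ω _; simp)]
  refine Finset.sum_congr rfl fun y hy => ?_
  rw [Finset.mem_powerset] at hy
  rw [Finset.filter_filter]
  congr 1; ext ω
  simp only [Finset.mem_filter, Finset.mem_univ, true_and]
  rw [and_comm, and_congr_right_iff]
  intro _
  rw [Finset.ext_iff]
  refine forall_congr' fun f => ?_
  simp only [Finset.mem_filter]
  have := @hy f
  tauto

theorem sum_cellMass (P : Ω → ℝ) (X : Ω → Set E) (S : Finset E) :
    ∑ y ∈ S.powerset, cellMass P X S y = ∑ ω, P ω := by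
  unfold cellMass
  rw [← Finset.sum_fiberwise_of_maps_to (s := Finset.univ)
    (t := S.powerset) (g := fun ω => S.filter fun f => f ∈ X ω) (by intro ω _; simp)]
  refine Finset.sum_congr rfl fun y hy => ?_
  rw [Finset.mem_powerset] at hy
  congr 1; ext ω
  simp only [Finset.mem_filter, and_congr_right_iff]
  intro _
  rw [Finset.ext_iff]
  refine forall_congr' fun f => ?_
  simp only [Finset.mem_filter]
  have := @hy f
  tauto

/-- If every conditional second moment of the absence of a further element is close to `w ^ 2`,
then the law of the random set on `U` is close to a product law in relative entropy. -/
theorem kl_cellMass_le (P : Ω → ℝ) (hP : ∀ ω, 0 ≤ P ω) (hP1 : ∑ ω, P ω = 1) (X : Ω → Set E)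
    (w ε : ℝ) (hw0 : 0 < w) (hw1 : w < 1) (U : Finset E)
    (hw : ∀ e ∈ U, ∑ ω with e ∉ X ω, P ω = w)
    (hε : ∀ e ∈ U, ∀ S ⊆ U, e ∉ S →
      ∑ y ∈ S.powerset, cellMassNot P X S y e ^ 2 / cellMass P X S y ≤ w ^ 2 + ε * (w * (1 - w))) :
    ∑ y ∈ U.powerset, cellMass P X U y *
      Real.log (cellMass P X U y / ((1 - w) ^ #y * w ^ (#U - #y))) ≤ #U * ε := by
  have hv : 0 < 1 - w := by linarith
  suffices h : ∀ S : Finset E, S ⊆ U → ∑ y ∈ S.powerset, cellMass P X S y *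
      Real.log (cellMass P X S y / ((1 - w) ^ #y * w ^ (#S - #y))) ≤ #S * ε from h U subset_rfl
  intro S
  induction S using Finset.induction_on with
  | empty =>
    intro _
    simp [cellMass, hP1]
  | insert e S he ih =>
    intro hS
    have heU := hS (Finset.mem_insert_self e S)
    have hSU := (Finset.subset_insert e S).trans hS
    have key : ∀ y ∈ S.powerset,
        cellMass P X (insert e S) y * Real.log (cellMass P X (insert e S) y /
            ((1 - w) ^ #y * w ^ (#(insert e S) - #y))) +
          cellMass P X (insert e S) (insert e y) *
            Real.log (cellMass P X (insert e S) (insert e y) /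
              ((1 - w) ^ #(insert e y) * w ^ (#(insert e S) - #(insert e y)))) ≤
          cellMass P X S y * Real.log (cellMass P X S y / ((1 - w) ^ #y * w ^ (#S - #y))) +
          (cellMassNot P X S y e ^ 2 / cellMass P X S y - 2 * w * cellMassNot P X S y e +
            w ^ 2 * cellMass P X S y) / (w * (1 - w)) := by
      intro y hy
      rw [Finset.mem_powerset] at hy
      have hey : e ∉ y := fun h => he (hy h)
      have hc := Finset.card_le_card hy
      rw [Finset.card_insert_of_notMem he, Finset.card_insert_of_notMem hey,
        cellMass_insert P X he hy, show #S + 1 - #y = (#S - #y) + 1 by omega,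
        show #S + 1 - (#y + 1) = #S - #y by omega,
        ← cellMassNot_add_cellMass_insert P X he]
      have := kl_split_le (cellMassNot P X S y e) (cellMass P X (insert e S) (insert e y))
        ((1 - w) ^ #y * w ^ (#S - #y)) w (Finset.sum_nonneg fun _ _ => hP _)
        (Finset.sum_nonneg fun _ _ => hP _) (by positivity) hw0 hw1
      convert this using 5 <;> ring
    rw [Finset.sum_powerset_insert he, ← Finset.sum_add_distrib]
    refine (Finset.sum_le_sum key).trans ?_
    rw [Finset.sum_add_distrib, ← Finset.sum_div, Finset.sum_add_distrib, Finset.sum_sub_distrib,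
      ← Finset.mul_sum, ← Finset.mul_sum, sum_cellMassNot, sum_cellMass, hw e heU, hP1,
      Finset.card_insert_of_notMem he]
    have h1 := hε e heU S hSU he
    have h2 : (∑ y ∈ S.powerset, cellMassNot P X S y e ^ 2 / cellMass P X S y - 2 * w * w +
        w ^ 2 * 1) / (w * (1 - w)) ≤ ε := by
      rw [div_le_iff₀ (by positivity)]; linarith
    push_cast
    linarith [ih hSU]

theorem sum_pow_card_mul_pow_card (w : ℝ) (U : Finset E) :
    ∑ y ∈ U.powerset, (1 - w) ^ #y * w ^ (#U - #y) = 1 := by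
  have := Finset.sum_pow_mul_eq_add_pow (1 - w) w U
  simpa using this

theorem sum_abs_cellMass_sub_le (P : Ω → ℝ) (hP : ∀ ω, 0 ≤ P ω) (hP1 : ∑ ω, P ω = 1)
    (X : Ω → Set E) (w ε : ℝ) (hw0 : 0 < w) (hw1 : w < 1) (U : Finset E)
    (hw : ∀ e ∈ U, ∑ ω with e ∉ X ω, P ω = w)
    (hε : ∀ e ∈ U, ∀ S ⊆ U, e ∉ S →
      ∑ y ∈ S.powerset, cellMassNot P X S y e ^ 2 / cellMass P X S y ≤ w ^ 2 + ε * (w * (1 - w))) :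
    ∑ y ∈ U.powerset, |cellMass P X U y - (1 - w) ^ #y * w ^ (#U - #y)| ≤ 2 * √(#U * ε) := by
  have hv : 0 < 1 - w := by linarith
  refine (sum_abs_sub_le_two_mul_sqrt_kl _ _ _ (fun y _ => Finset.sum_nonneg fun _ _ => hP _)
    (fun y _ => by positivity) ((sum_cellMass P X U).trans hP1) (sum_pow_card_mul_pow_card w U)).trans ?_
  gcongr
  exact kl_cellMass_le P hP hP1 X w ε hw0 hw1 U hw hε

/-- Sedrakyan's lemma, allowing zero denominators. -/
theorem sq_sum_div_le_sum_sq_div_of_le {α : Type*} (s : Finset α) (N T : α → ℝ)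
    (hN : ∀ a ∈ s, 0 ≤ N a) (hT : ∀ a ∈ s, N a ≤ T a) :
    (∑ a ∈ s, N a) ^ 2 / ∑ a ∈ s, T a ≤ ∑ a ∈ s, N a ^ 2 / T a := by
  have hT0 : ∀ a ∈ s, 0 ≤ T a := fun a ha => (hN a ha).trans (hT a ha)
  have h0 : ∀ a ∈ s, 0 ≤ N a ^ 2 / T a := fun a ha => div_nonneg (sq_nonneg _) (hT0 a ha)
  refine div_le_of_le_mul₀ (Finset.sum_nonneg hT0) (Finset.sum_nonneg h0) ?_
  refine Finset.sum_sq_le_sum_mul_sum_of_sq_le_mul s h0 hT0 fun a ha => le_of_eq ?_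
  rcases (hT0 a ha).eq_or_lt with h | h
  · have : N a = 0 := le_antisymm ((hT a ha).trans h.ge) (hN a ha)
    simp [this]
  · field_simp

/-- Conditioning on more information increases the conditional second moment. -/
theorem sum_cellMassNot_sq_div_le {δ : Type*} [Fintype δ] (P : Ω → ℝ) (hP : ∀ ω, 0 ≤ P ω)
    (X : Ω → Set E) (S : Finset E) (e : E) (D : Ω → δ)
    (hD : ∀ ω ω', D ω = D ω' → ∀ f ∈ S, (f ∈ X ω ↔ f ∈ X ω')) :
    ∑ y ∈ S.powerset, cellMassNot P X S y e ^ 2 / cellMass P X S y ≤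
      ∑ d, (∑ ω with D ω = d ∧ e ∉ X ω, P ω) ^ 2 / ∑ ω with D ω = d, P ω := by
  have hK : ∀ ω ω', D ω = D ω' → (S.filter fun f => f ∈ X ω) = S.filter fun f => f ∈ X ω' :=
    fun ω ω' h => Finset.filter_congr (hD ω ω' h)
  obtain ⟨h, hh⟩ : ∃ h : δ → Finset E, ∀ ω, h (D ω) = S.filter fun f => f ∈ X ω := by
    refine ⟨fun d => if hd : ∃ ω, D ω = d then S.filter fun f => f ∈ X hd.choose else ∅,
      fun ω => ?_⟩
    have hd : ∃ ω', D ω' = D ω := ⟨ω, rfl⟩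
    simp only [hd, dite_true]
    exact hK _ _ hd.choose_spec
  have hcell : ∀ y ∈ S.powerset, ∀ ω, (∀ f ∈ S, (f ∈ X ω ↔ f ∈ y)) ↔ h (D ω) = y := by
    intro y hy ω
    rw [Finset.mem_powerset] at hy
    rw [hh, Finset.ext_iff]
    refine forall_congr' fun f => ?_
    simp only [Finset.mem_filter]
    have := @hy f
    tauto
  have hnn : ∀ d, 0 ≤ (∑ ω with D ω = d ∧ e ∉ X ω, P ω) ^ 2 / ∑ ω with D ω = d, P ω :=
    fun d => div_nonneg (sq_nonneg _) (Finset.sum_nonneg fun _ _ => hP _)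
  have hy : ∀ y ∈ S.powerset, cellMassNot P X S y e ^ 2 / cellMass P X S y ≤
      ∑ d with h d = y, (∑ ω with D ω = d ∧ e ∉ X ω, P ω) ^ 2 / ∑ ω with D ω = d, P ω := by
    intro y hy
    have e1 : cellMass P X S y = ∑ d with h d = y, ∑ ω with D ω = d, P ω := by
      unfold cellMass
      rw [Finset.filter_congr fun ω _ => hcell y hy ω,
        ← Finset.sum_fiberwise_of_maps_to (t := Finset.univ.filter fun d => h d = y) (g := D)
          (by simp)]
      refine Finset.sum_congr rfl fun d hd => ?_
      rw [Finset.filter_filter]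
      congr 1; ext ω
      simp only [Finset.mem_filter, Finset.mem_univ, true_and] at hd ⊢
      exact ⟨fun h => h.2, fun h => ⟨h ▸ hd, h⟩⟩
    have e2 : cellMassNot P X S y e =
        ∑ d with h d = y, ∑ ω with D ω = d ∧ e ∉ X ω, P ω := by
      unfold cellMassNot
      rw [Finset.filter_congr fun ω _ => and_congr_left' (hcell y hy ω),
        ← Finset.sum_fiberwise_of_maps_to (t := Finset.univ.filter fun d => h d = y) (g := D)
          (by simp +contextual)]
      refine Finset.sum_congr rfl fun d hd => ?_
      rw [Finset.filter_filter]
      congr 1; ext ω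
      simp only [Finset.mem_filter, Finset.mem_univ, true_and] at hd ⊢
      exact ⟨fun h => ⟨h.2, h.1.2⟩, fun h => ⟨⟨h.1 ▸ hd, h.2⟩, h.1⟩⟩
    rw [e1, e2]
    refine sq_sum_div_le_sum_sq_div_of_le _ _ _ (fun d _ => Finset.sum_nonneg fun _ _ => hP _)
      fun d _ => Finset.sum_le_sum_of_subset_of_nonneg ?_ fun _ _ _ => hP _
    intro ω
    simp only [Finset.mem_filter, Finset.mem_univ, true_and]
    exact fun h => h.1
  refine (Finset.sum_le_sum hy).trans ?_
  refine (Finset.sum_fiberwise_le_sum_of_sum_fiber_nonneg (t := S.powerset) ?_)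
  intro y _
  exact Finset.sum_nonneg fun d _ => hnn d
end Reveal

section Weights
open scoped Classical Finset symmDiff

variable {M : Type*}

/-- The indicator of disjointness. -/
noncomputable def disjInd (L A : Set M) : ℝ := if Disjoint L A then 1 else 0

/-- The indicator of membership. -/
noncomputable def memInd (e : M) (L : Set M) : ℝ := if e ∈ L then 1 else 0

theorem disjInd_comm (L A : Set M) : disjInd L A = disjInd A L := by
  simp only [disjInd, disjoint_comm]

theorem disjInd_nonneg (L A : Set M) : 0 ≤ disjInd L A := by unfold disjInd; split_ifs <;> simp

theorem disjInd_le_one (L A : Set M) : disjInd L A ≤ 1 := by unfold disjInd; split_ifs <;> simp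

theorem memInd_nonneg (e : M) (L : Set M) : 0 ≤ memInd e L := by unfold memInd; split_ifs <;> simp

theorem memInd_le_one (e : M) (L : Set M) : memInd e L ≤ 1 := by unfold memInd; split_ifs <;> simp

theorem disjInd_mul_disjInd (L L' A : Set M) :
    disjInd L A * disjInd L' A = disjInd (L ∪ L') A := by
  unfold disjInd
  simp only [Set.disjoint_union_left]
  split_ifs <;> simp_all

theorem memInd_symmDiff_singleton {e f : M} (h : f ≠ e) (L : Set M) :
    memInd f (L ∆ {e}) = memInd f L := by
  simp [memInd, Set.mem_symmDiff, h]

theorem disjInd_le_symmDiff_singleton (A : Set M) {L : Set M} {e : M} (he : e ∈ L) :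
    disjInd L A ≤ disjInd (L ∆ {e}) A := by
  unfold disjInd
  split_ifs with h h' h'
  · rfl
  · refine absurd (h.mono_left ?_) h'
    intro f hf
    rcases hf with hf | hf
    · exact hf.1
    · exact absurd (hf.1 ▸ he) hf.2
  · simp
  · rfl

variable [Fintype M] (p : ℝ)

/-- The probability of `L` as the value of a random set containing each element of `M` with
probability `p`. -/
noncomputable def bernoulliWeight (L : Set M) : ℝ := ∏ e, if e ∈ L then p else 1 - p

/-- The probability that a random set containing each element of `M` with probability `p` is
disjoint from `L`. -/
noncomputable def avoidProb (L : Set M) : ℝ := ∏ e, if e ∈ L then 1 - p else 1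

theorem disjInd_eq_prod (L A : Set M) :
    disjInd L A = ∏ e, if e ∈ L ∧ e ∈ A then (0 : ℝ) else 1 := by
  unfold disjInd
  split_ifs with h
  · rw [Finset.prod_eq_one]
    intro e _
    rw [if_neg]
    exact fun he => Set.disjoint_left.1 h he.1 he.2
  · obtain ⟨e, he⟩ := Set.not_disjoint_iff.1 h
    rw [Finset.prod_eq_zero (Finset.mem_univ e)]
    simp [he]

theorem sum_set_prod_ite (f g : M → ℝ) :
    ∑ L : Set M, ∏ e, (if e ∈ L then f e else g e) = ∏ e, (f e + g e) := by
  rw [Fintype.prod_add, ← Fintype.finsetEquivSet.sum_comp]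
  refine Finset.sum_congr rfl fun t _ => ?_
  rw [← Finset.prod_mul_prod_compl t]
  congr 1
  · exact Finset.prod_congr rfl fun e he => by simp [he]
  · exact Finset.prod_congr rfl fun e he => by simp [Finset.mem_compl.1 he]

theorem sum_bernoulliWeight : ∑ L : Set M, bernoulliWeight p L = 1 := by
  simp [bernoulliWeight, sum_set_prod_ite]

theorem sum_bernoulliWeight_mul_disjInd (L : Set M) :
    ∑ A : Set M, bernoulliWeight p A * disjInd L A = avoidProb p L := by
  have : ∀ A : Set M, bernoulliWeight p A * disjInd L A =
      ∏ e, if e ∈ A then (if e ∈ L then 0 else p) else 1 - p := by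
    intro A
    rw [bernoulliWeight, disjInd_eq_prod, ← Finset.prod_mul_distrib]
    refine Finset.prod_congr rfl fun e _ => ?_
    by_cases h1 : e ∈ A <;> by_cases h2 : e ∈ L <;> simp [h1, h2]
  simp_rw [this, sum_set_prod_ite, avoidProb]
  refine Finset.prod_congr rfl fun e _ => ?_
  split_ifs <;> ring

theorem sum_bernoulliWeight_mul_avoidProb :
    ∑ L : Set M, bernoulliWeight p L * avoidProb p L = (1 - p ^ 2) ^ Fintype.card M := by
  have : ∀ L : Set M, bernoulliWeight p L * avoidProb p L =
      ∏ e, if e ∈ L then p * (1 - p) else 1 - p := by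
    intro L
    rw [bernoulliWeight, avoidProb, ← Finset.prod_mul_distrib]
    refine Finset.prod_congr rfl fun e _ => ?_
    split_ifs <;> simp
  simp_rw [this, sum_set_prod_ite]
  rw [Finset.prod_const, Finset.card_univ]
  ring

theorem sum_bernoulliWeight_mul_avoidProb_sq :
    ∑ L : Set M, bernoulliWeight p L * avoidProb p L ^ 2 =
      (1 - 2 * p ^ 2 + p ^ 3) ^ Fintype.card M := by
  have : ∀ L : Set M, bernoulliWeight p L * avoidProb p L ^ 2 =
      ∏ e, if e ∈ L then p * (1 - p) ^ 2 else 1 - p := by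
    intro L
    rw [bernoulliWeight, avoidProb, ← Finset.prod_pow, ← Finset.prod_mul_distrib]
    refine Finset.prod_congr rfl fun e _ => ?_
    split_ifs <;> simp
  simp_rw [this, sum_set_prod_ite]
  rw [Finset.prod_const, Finset.card_univ]
  ring

variable {p}

theorem bernoulliWeight_nonneg (h0 : 0 ≤ p) (h1 : p ≤ 1) (L : Set M) : 0 ≤ bernoulliWeight p L :=
  Finset.prod_nonneg fun e _ => by split_ifs <;> linarith

theorem avoidProb_nonneg (h1 : p ≤ 1) (L : Set M) : 0 ≤ avoidProb p L :=
  Finset.prod_nonneg fun e _ => by split_ifs <;> linarith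

theorem avoidProb_le_one (h0 : 0 ≤ p) (h1 : p ≤ 1) (L : Set M) : avoidProb p L ≤ 1 :=
  Finset.prod_le_one (fun e _ => by split_ifs <;> linarith)
    fun e _ => by split_ifs <;> linarith [h0]

theorem one_sub_avoidProb_le (h1 : p ≤ 1) (L : Set M) :
    1 - avoidProb p L ≤ p * ∑ e, memInd e L := by
  have h : avoidProb p L = (1 - p) ^ #{e | e ∈ L} := by
    simp [avoidProb, Finset.prod_ite]
  have h2 : ∑ e, memInd e L = #{e | e ∈ L} := by
    simp [memInd]
  have := one_add_mul_le_pow (a := -p) (by linarith) #{e | e ∈ L}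
  rw [h, h2, sub_eq_add_neg 1 p]
  linarith

theorem avoidProb_union_le (h1 : p ≤ 1) (L L' : Set M) :
    avoidProb p (L ∪ L') ≤ avoidProb p L * avoidProb p L' +
      p * ∑ e, memInd e L * memInd e L' * avoidProb p (L ∪ L') := by
  have h2 : avoidProb p L * avoidProb p L' = avoidProb p (L ∪ L') * avoidProb p (L ∩ L') := by
    simp only [avoidProb, ← Finset.prod_mul_distrib]
    refine Finset.prod_congr rfl fun e _ => ?_
    by_cases ha : e ∈ L <;> by_cases hb : e ∈ L' <;> simp [ha, hb]
  have h3 : ∀ e, memInd e L * memInd e L' = memInd e (L ∩ L') := by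
    intro e
    by_cases ha : e ∈ L <;> by_cases hb : e ∈ L' <;> simp [memInd, ha, hb]
  have h4 := mul_le_mul_of_nonneg_left (one_sub_avoidProb_le h1 (L ∩ L'))
    (avoidProb_nonneg h1 (L ∪ L'))
  simp_rw [h3, ← Finset.sum_mul]
  rw [h2]
  linarith

theorem bernoulliWeight_symmDiff_mul (L : Set M) (e : M) :
    bernoulliWeight p (L ∆ {e}) * (if e ∈ L then p else 1 - p) =
      bernoulliWeight p L * (if e ∈ L then 1 - p else p) := by
  unfold bernoulliWeight
  rw [← Finset.mul_prod_erase _ _ (Finset.mem_univ e),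
    ← Finset.mul_prod_erase (a := e) Finset.univ (fun f => if f ∈ L then p else 1 - p)
      (Finset.mem_univ e)]
  have : ∀ f ∈ Finset.univ.erase e, (if f ∈ L ∆ {e} then p else 1 - p) =
      if f ∈ L then p else 1 - p := by
    intro f hf
    have : f ≠ e := (Finset.mem_erase.1 hf).1
    simp [Set.mem_symmDiff, this]
  rw [Finset.prod_congr rfl this]
  by_cases h : e ∈ L <;> simp [Set.mem_symmDiff, h] <;> ring

/-- Membership of `e` is negatively correlated with functions that decrease in the coordinate
`e`. -/
theorem sum_bernoulliWeight_mul_memInd_le (h0 : 0 ≤ p) (h1 : p ≤ 1) (e : M) (F : Set M → ℝ)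
    (hF : ∀ L, e ∈ L → F L ≤ F (L ∆ {e})) :
    ∑ L, bernoulliWeight p L * memInd e L * F L ≤ p * ∑ L, bernoulliWeight p L * F L := by
  have hinv : Function.Involutive fun L : Set M => L ∆ {e} := fun L => by
    simp only [symmDiff_symmDiff_cancel_right]
  have hflip : ∑ L, (1 - p) * (bernoulliWeight p L * memInd e L * F L) ≤
      ∑ L : Set M, p * (bernoulliWeight p L * (1 - memInd e L) * F L) := by
    rw [← Equiv.sum_comp (hinv.toPerm _) fun L : Set M =>
      p * (bernoulliWeight p L * (1 - memInd e L) * F L)]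
    refine Finset.sum_le_sum fun L _ => ?_
    have h := bernoulliWeight_symmDiff_mul (p := p) L e
    simp only [Function.Involutive.coe_toPerm]
    by_cases he : e ∈ L
    · simp only [he, if_true] at h
      have h3 := mul_le_mul_of_nonneg_left (hF L he)
        (mul_nonneg (bernoulliWeight_nonneg h0 h1 L) (sub_nonneg.2 h1))
      simp only [memInd, Set.mem_symmDiff, he, Set.mem_singleton_iff]
      simp
      linear_combination h3 - F (L ∆ {e}) * h
    · simp [memInd, Set.mem_symmDiff, he]
  have hsum : ∑ L, bernoulliWeight p L * F L =
      ∑ L, bernoulliWeight p L * memInd e L * F L +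
        ∑ L, bernoulliWeight p L * (1 - memInd e L) * F L := by
    rw [← Finset.sum_add_distrib]
    exact Finset.sum_congr rfl fun L _ => by ring
  rw [← Finset.mul_sum, ← Finset.mul_sum] at hflip
  rw [hsum]
  linarith

/-- Membership of `e` is independent of functions that do not depend on `e`. -/
theorem sum_bernoulliWeight_mul_memInd (h0 : 0 ≤ p) (h1 : p ≤ 1) (e : M) (F : Set M → ℝ)
    (hF : ∀ L, e ∈ L → F (L ∆ {e}) = F L) :
    ∑ L, bernoulliWeight p L * memInd e L * F L = p * ∑ L, bernoulliWeight p L * F L := by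
  refine le_antisymm
    (sum_bernoulliWeight_mul_memInd_le h0 h1 e F fun L he => (hF L he).ge) ?_
  have := sum_bernoulliWeight_mul_memInd_le h0 h1 e (fun L => -F L)
    fun L he => (neg_le_neg_iff.2 (hF L he).le)
  simp only [mul_neg, Finset.sum_neg_distrib] at this
  linarith

theorem avoidProb_le_symmDiff_singleton (h0 : 0 ≤ p) (h1 : p ≤ 1) {L : Set M} {e : M}
    (he : e ∈ L) : avoidProb p L ≤ avoidProb p (L ∆ {e}) := by
  simp_rw [← sum_bernoulliWeight_mul_disjInd]
  exact Finset.sum_le_sum fun A _ => mul_le_mul_of_nonneg_left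
    (disjInd_le_symmDiff_singleton A he) (bernoulliWeight_nonneg h0 h1 A)

theorem sum_memInd_mul_avoidProb_le (h0 : 0 ≤ p) (h1 : p ≤ 1) (e : M) :
    ∑ L, bernoulliWeight p L * (memInd e L * avoidProb p L) ≤
      p * (1 - p ^ 2) ^ Fintype.card M := by
  rw [← sum_bernoulliWeight_mul_avoidProb]
  simp_rw [← mul_assoc]
  exact sum_bernoulliWeight_mul_memInd_le h0 h1 e _
    fun L he => avoidProb_le_symmDiff_singleton h0 h1 he

theorem sum_memInd_mul_avoidProb_sq_le (h0 : 0 ≤ p) (h1 : p ≤ 1) (e : M) :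
    ∑ L, bernoulliWeight p L * (memInd e L * avoidProb p L ^ 2) ≤
      p * (1 - 2 * p ^ 2 + p ^ 3) ^ Fintype.card M := by
  rw [← sum_bernoulliWeight_mul_avoidProb_sq]
  simp_rw [← mul_assoc]
  exact sum_bernoulliWeight_mul_memInd_le h0 h1 e _ fun L he =>
    pow_le_pow_left₀ (avoidProb_nonneg h1 L) (avoidProb_le_symmDiff_singleton h0 h1 he) 2

theorem sum_memInd_mul_memInd_mul_avoidProb_le (h0 : 0 ≤ p) (h1 : p ≤ 1) {e f : M} (h : f ≠ e) :
    ∑ L, bernoulliWeight p L * (memInd e L * memInd f L * avoidProb p L) ≤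
      p ^ 2 * (1 - p ^ 2) ^ Fintype.card M := by
  rw [show p ^ 2 * (1 - p ^ 2) ^ Fintype.card M = p * (p * (1 - p ^ 2) ^ Fintype.card M) by ring]
  refine le_trans ?_ (mul_le_mul_of_nonneg_left (sum_memInd_mul_avoidProb_le h0 h1 f) h0)
  simp_rw [mul_assoc, ← mul_assoc (bernoulliWeight p _) (memInd e _)]
  refine sum_bernoulliWeight_mul_memInd_le h0 h1 e _ fun L he => ?_
  rw [memInd_symmDiff_singleton h]
  exact mul_le_mul_of_nonneg_left (avoidProb_le_symmDiff_singleton h0 h1 he) (memInd_nonneg f L)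

theorem sum_bernoulliWeight_mul_sq (f : Set M → ℝ) :
    ∑ A, bernoulliWeight p A * (∑ L, f L * disjInd L A) ^ 2 =
      ∑ L, ∑ L', f L * f L' * avoidProb p (L ∪ L') := by
  simp_rw [← sum_bernoulliWeight_mul_disjInd, ← disjInd_mul_disjInd, sq, Finset.sum_mul_sum,
    Finset.mul_sum]
  rw [Finset.sum_comm]
  refine Finset.sum_congr rfl fun L _ => ?_
  rw [Finset.sum_comm]
  refine Finset.sum_congr rfl fun L' _ => Finset.sum_congr rfl fun A _ => ?_
  ring

theorem sum_bernoulliWeight_mul_sq_le (h1 : p ≤ 1) (f : Set M → ℝ)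
    (hf : ∀ L, 0 ≤ f L) :
    ∑ A, bernoulliWeight p A * (∑ L, f L * disjInd L A) ^ 2 ≤
      (∑ L, f L * avoidProb p L) ^ 2 +
        p * ∑ e, ∑ A, bernoulliWeight p A * (∑ L, f L * memInd e L * disjInd L A) ^ 2 := by
  simp_rw [sum_bernoulliWeight_mul_sq]
  have : ∀ L L', f L * f L' * avoidProb p (L ∪ L') ≤
      f L * avoidProb p L * (f L' * avoidProb p L') +
        p * ∑ e, f L * memInd e L * (f L' * memInd e L') * avoidProb p (L ∪ L') := by
    intro L L'
    refine (mul_le_mul_of_nonneg_left (avoidProb_union_le h1 L L')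
      (mul_nonneg (hf L) (hf L'))).trans_eq ?_
    rw [mul_add, Finset.mul_sum, Finset.mul_sum, Finset.mul_sum]
    congr 1
    · ring
    · exact Finset.sum_congr rfl fun e _ => by ring
  refine (Finset.sum_le_sum fun L _ => Finset.sum_le_sum fun L' _ => this L L').trans_eq ?_
  simp_rw [Finset.sum_add_distrib]
  congr 1
  · rw [sq, Finset.sum_mul_sum]
  · simp_rw [← Finset.mul_sum]
    congr 1
    rw [Finset.sum_comm (s := (Finset.univ : Finset M))]
    exact Finset.sum_congr rfl fun L _ => Finset.sum_comm

section Pattern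
variable {ξ : Type*} (p) (φ : Set M → ξ)

/-- The joint weight of `L` and the event `φ L = x`. -/
noncomputable def patternWeight (x : ξ) (L : Set M) : ℝ :=
  if φ L = x then bernoulliWeight p L else 0

theorem sum_patternWeight [Fintype ξ] (L : Set M) :
    ∑ x, patternWeight p φ x L = bernoulliWeight p L := by
  simp [patternWeight]

theorem sum_sum_patternWeight_mul [Fintype ξ] (g : Set M → ℝ) :
    ∑ x, ∑ L, patternWeight p φ x L * g L = ∑ L, bernoulliWeight p L * g L := by
  rw [Finset.sum_comm]
  simp_rw [← Finset.sum_mul, sum_patternWeight]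

/-- The second moment of the conditional expectation of `g L * disjInd L A` given `φ L` and `A`. -/
noncomputable def condMoment [Fintype ξ] (g : Set M → ℝ) : ℝ :=
  ∑ x, (∑ A, bernoulliWeight p A * (∑ L, patternWeight p φ x L * g L * disjInd L A) ^ 2) /
    ∑ L, patternWeight p φ x L

variable {p}

theorem patternWeight_nonneg (h0 : 0 ≤ p) (h1 : p ≤ 1) (x : ξ) (L : Set M) :
    0 ≤ patternWeight p φ x L := by
  unfold patternWeight; split_ifs
  exacts [bernoulliWeight_nonneg h0 h1 L, le_rfl]

theorem condMoment_nonneg [Fintype ξ] (h0 : 0 ≤ p) (h1 : p ≤ 1) (g : Set M → ℝ) :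
    0 ≤ condMoment p φ g :=
  Finset.sum_nonneg fun x _ => div_nonneg
    (Finset.sum_nonneg fun A _ => mul_nonneg (bernoulliWeight_nonneg h0 h1 A) (sq_nonneg _))
    (Finset.sum_nonneg fun L _ => patternWeight_nonneg φ h0 h1 x L)

theorem sum_patternWeight_mul_memInd_le (h0 : 0 ≤ p) (h1 : p ≤ 1) (e : M) (x : ξ)
    (F : Set M → ℝ) (hφ : ∀ L, e ∈ L → F L ≠ 0 → φ (L ∆ {e}) = φ L)
    (hF0 : ∀ L, 0 ≤ F L) (hF : ∀ L, e ∈ L → F L ≤ F (L ∆ {e})) :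
    ∑ L, patternWeight p φ x L * memInd e L * F L ≤ p * ∑ L, patternWeight p φ x L * F L := by
  have := sum_bernoulliWeight_mul_memInd_le h0 h1 e (fun L => (if φ L = x then 1 else 0) * F L)
    (fun L he => by
      rcases eq_or_ne (F L) 0 with h | h
      · simp only [h, mul_zero]
        exact mul_nonneg (by split_ifs <;> simp) (hF0 _)
      · simp only [hφ L he h]
        exact mul_le_mul_of_nonneg_left (hF L he) (by split_ifs <;> simp))
  refine Eq.trans_le (Finset.sum_congr rfl fun L _ => ?_)
    (this.trans_eq (congrArg (p * ·) (Finset.sum_congr rfl fun L _ => ?_)))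
  · simp only [patternWeight]; split_ifs <;> ring
  · simp only [patternWeight]; split_ifs <;> ring

theorem condMoment_le_add [Fintype ξ] (h0 : 0 ≤ p) (h1 : p ≤ 1) (g : Set M → ℝ)
    (hg0 : ∀ L, 0 ≤ g L) (hg1 : ∀ L, g L ≤ 1) :
    condMoment p φ g ≤ ∑ L, bernoulliWeight p L * (g L * avoidProb p L ^ 2) +
      p * ∑ e, condMoment p φ (fun L => g L * memInd e L) := by
  have hf0 : ∀ x L, 0 ≤ patternWeight p φ x L := patternWeight_nonneg φ h0 h1
  have hcell : ∀ x, (∑ A, bernoulliWeight p A *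
      (∑ L, patternWeight p φ x L * g L * disjInd L A) ^ 2) / ∑ L, patternWeight p φ x L ≤
      ∑ L, patternWeight p φ x L * (g L * avoidProb p L ^ 2) + p * ∑ e, (∑ A, bernoulliWeight p A *
        (∑ L, patternWeight p φ x L * (g L * memInd e L) * disjInd L A) ^ 2) /
          ∑ L, patternWeight p φ x L := by
    intro x
    refine (div_le_div_of_nonneg_right (sum_bernoulliWeight_mul_sq_le h1
      (fun L => patternWeight p φ x L * g L) fun L => mul_nonneg (hf0 x L) (hg0 L))
      (Finset.sum_nonneg fun L _ => hf0 x L)).trans ?_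
    simp only [← mul_assoc]
    rw [add_div, mul_div_assoc, Finset.sum_div]
    refine add_le_add_left ?_ _
    have hga : ∀ L, g L * avoidProb p L ≤ 1 := fun L =>
      mul_le_one₀ (hg1 L) (avoidProb_nonneg h1 L) (avoidProb_le_one h0 h1 L)
    have hga0 : ∀ L, 0 ≤ g L * avoidProb p L := fun L => mul_nonneg (hg0 L) (avoidProb_nonneg h1 L)
    refine (sq_sum_div_le_sum_sq_div_of_le _ _ (patternWeight p φ x)
      (fun L _ => by rw [mul_assoc]; exact mul_nonneg (hf0 x L) (hga0 L))
      fun L _ => by rw [mul_assoc]; exact mul_le_of_le_one_right (hf0 x L) (hga L)).trans ?_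
    refine Finset.sum_le_sum fun L _ => ?_
    rcases (hf0 x L).eq_or_lt with h | h
    · simp [← h]
    · have : (patternWeight p φ x L * g L * avoidProb p L) ^ 2 / patternWeight p φ x L =
          g L * (patternWeight p φ x L * g L * avoidProb p L ^ 2) := by field_simp
      rw [this]
      exact mul_le_of_le_one_left
        (mul_nonneg (mul_nonneg (hf0 x L) (hg0 L)) (sq_nonneg _)) (hg1 L)
  refine (Finset.sum_le_sum fun x _ => hcell x).trans_eq ?_
  rw [Finset.sum_add_distrib, sum_sum_patternWeight_mul, ← Finset.mul_sum, Finset.sum_comm]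
  rfl

theorem condMoment_mul_memInd_le [Fintype ξ] (h0 : 0 ≤ p) (h1 : p ≤ 1) (g : Set M → ℝ)
    (hg0 : ∀ L, 0 ≤ g L) (e : M) (hφ : ∀ L, φ (L ∆ {e}) = φ L) (hg : ∀ L, g (L ∆ {e}) = g L) :
    condMoment p φ (fun L => g L * memInd e L) ≤ p ^ 2 * condMoment p φ g := by
  unfold condMoment
  rw [Finset.mul_sum]
  refine Finset.sum_le_sum fun x _ => ?_
  rw [← mul_div_assoc, Finset.mul_sum]
  refine div_le_div_of_nonneg_right (Finset.sum_le_sum fun A _ => ?_)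
    (Finset.sum_nonneg fun L _ => patternWeight_nonneg φ h0 h1 x L)
  have hle := sum_patternWeight_mul_memInd_le φ h0 h1 e x (fun L => g L * disjInd L A)
    (fun L _ _ => hφ L) (fun L => mul_nonneg (hg0 L) (disjInd_nonneg L A))
    (fun L he => by
      rw [hg]; exact mul_le_mul_of_nonneg_left (disjInd_le_symmDiff_singleton A he) (hg0 L))
  have hle' : ∑ L, patternWeight p φ x L * (g L * memInd e L) * disjInd L A ≤
      p * ∑ L, patternWeight p φ x L * g L * disjInd L A := by
    refine Eq.trans_le (Finset.sum_congr rfl fun L _ => by ring)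
      (hle.trans_eq (congrArg (p * ·) (Finset.sum_congr rfl fun L _ => by ring)))
  have hsq := pow_le_pow_left₀ (Finset.sum_nonneg fun L _ =>
    mul_nonneg (mul_nonneg (patternWeight_nonneg φ h0 h1 x L)
      (mul_nonneg (hg0 L) (memInd_nonneg e L))) (disjInd_nonneg L A)) hle' 2
  calc _ ≤ bernoulliWeight p A * (p * ∑ L, patternWeight p φ x L * g L * disjInd L A) ^ 2 :=
        mul_le_mul_of_nonneg_left hsq (bernoulliWeight_nonneg h0 h1 A)
    _ = _ := by ring

theorem condMoment_le_mul [Fintype ξ] (h0 : 0 ≤ p) (h1 : p ≤ 1) (g : Set M → ℝ)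
    (hg0 : ∀ L, 0 ≤ g L) (κ : ℝ) (hκ0 : 0 ≤ κ)
    (hκ : ∀ x, ∑ L, patternWeight p φ x L * g L ≤ κ * ∑ L, patternWeight p φ x L) :
    condMoment p φ g ≤ κ * ∑ L, bernoulliWeight p L * (g L * avoidProb p L) := by
  have hf0 : ∀ x L, 0 ≤ patternWeight p φ x L := patternWeight_nonneg φ h0 h1
  have hcell : ∀ x, (∑ A, bernoulliWeight p A *
      (∑ L, patternWeight p φ x L * g L * disjInd L A) ^ 2) / ∑ L, patternWeight p φ x L ≤
      κ * ∑ L, patternWeight p φ x L * (g L * avoidProb p L) := by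
    intro x
    have hD0 : 0 ≤ ∑ L, patternWeight p φ x L := Finset.sum_nonneg fun L _ => hf0 x L
    have hS0 : ∀ A, 0 ≤ ∑ L, patternWeight p φ x L * g L * disjInd L A := fun A =>
      Finset.sum_nonneg fun L _ => mul_nonneg (mul_nonneg (hf0 x L) (hg0 L)) (disjInd_nonneg L A)
    have hS : ∑ L, patternWeight p φ x L * (g L * avoidProb p L) =
        ∑ A, bernoulliWeight p A * ∑ L, patternWeight p φ x L * g L * disjInd L A := by
      simp_rw [← sum_bernoulliWeight_mul_disjInd, Finset.mul_sum]
      rw [Finset.sum_comm]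
      exact Finset.sum_congr rfl fun L _ => Finset.sum_congr rfl fun A _ => by ring
    rw [hS, Finset.sum_div, Finset.mul_sum]
    refine Finset.sum_le_sum fun A _ => ?_
    rw [mul_div_assoc, mul_left_comm]
    refine mul_le_mul_of_nonneg_left (div_le_of_le_mul₀ hD0 (mul_nonneg hκ0 (hS0 A)) ?_)
      (bernoulliWeight_nonneg h0 h1 A)
    have : ∑ L, patternWeight p φ x L * g L * disjInd L A ≤ κ * ∑ L, patternWeight p φ x L :=
      (Finset.sum_le_sum fun L _ => mul_le_of_le_one_right (mul_nonneg (hf0 x L) (hg0 L))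
        (disjInd_le_one L A)).trans (hκ x)
    nlinarith [mul_le_mul_of_nonneg_left this (hS0 A)]
  refine (Finset.sum_le_sum fun x _ => hcell x).trans_eq ?_
  rw [← Finset.mul_sum, sum_sum_patternWeight_mul]

theorem condMoment_le [Fintype ξ] (h0 : 0 ≤ p) (h1 : p ≤ 1) (g : Set M → ℝ)
    (hg0 : ∀ L, 0 ≤ g L) (hg1 : ∀ L, g L ≤ 1) :
    condMoment p φ g ≤ ∑ L, bernoulliWeight p L * (g L * avoidProb p L) := by
  have := condMoment_le_mul φ h0 h1 g hg0 1 zero_le_one fun x => by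
    rw [one_mul]
    exact Finset.sum_le_sum fun L _ =>
      mul_le_of_le_one_right (patternWeight_nonneg φ h0 h1 x L) (hg1 L)
  simpa using this

/-- If `φ L` does not depend on the other elements of `C` once `L` contains an element of `C`, then
the conditional probability given `φ L` that `L` contains a given element of `C` is small. -/
theorem sum_patternWeight_mul_memInd_le_of_forall (h0 : 0 < p) (h1 : p ≤ 1) (C : Finset M)
    (hC : ∀ e ∈ C, ∀ f ∈ C, f ≠ e → ∀ L, e ∈ L → φ (L ∆ {f}) = φ L) {e : M} (he : e ∈ C) (x : ξ) :
    ∑ L, patternWeight p φ x L * memInd e L ≤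
      (p + 1 / #C) * ∑ L, patternWeight p φ x L := by
  set f := patternWeight p φ x with hf
  have hf0 : ∀ L, 0 ≤ f L := patternWeight_nonneg φ h0.le h1 x
  have hpair : ∀ a ∈ C, ∀ b ∈ C, b ≠ a →
      ∑ L, f L * (memInd a L * memInd b L) = p * ∑ L, f L * memInd a L := by
    intro a ha b hb hab
    have := sum_bernoulliWeight_mul_memInd h0.le h1 b
      (fun L => (if φ L = x then 1 else 0) * memInd a L) (fun L _ => by
        simp only [memInd_symmDiff_singleton hab.symm]
        by_cases haL : a ∈ L
        · rw [hC a ha b hb hab L haL]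
        · simp [memInd, haL])
    refine Eq.trans (Finset.sum_congr rfl fun L _ => ?_)
      (this.trans (congrArg (p * ·) (Finset.sum_congr rfl fun L _ => ?_)))
    · simp only [hf, patternWeight]; split_ifs <;> ring
    · simp only [hf, patternWeight]; split_ifs <;> ring
  set γ := ∑ L, f L * memInd e L with hγ
  have hγ0 : 0 ≤ γ := Finset.sum_nonneg fun L _ => mul_nonneg (hf0 L) (memInd_nonneg e L)
  have heq : ∀ a ∈ C, ∑ L, f L * memInd a L = γ := by
    intro a ha
    rcases eq_or_ne a e with rfl | h
    · rfl
    · have h2 := hpair a ha e he h.symm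
      simp_rw [mul_comm (memInd a _)] at h2
      rw [hpair e he a ha h] at h2
      exact (mul_left_cancel₀ h0.ne' h2).symm
  have hc : (0 : ℝ) < #C := by exact_mod_cast Finset.card_pos.2 ⟨e, he⟩
  have hK : ∑ L, f L * ∑ a ∈ C, memInd a L = #C * γ := by
    simp_rw [Finset.mul_sum]
    rw [Finset.sum_comm, Finset.sum_congr rfl heq, Finset.sum_const, nsmul_eq_mul]
  have hK2 : ∑ L, f L * (∑ a ∈ C, memInd a L) ^ 2 ≤ #C * γ * (1 + #C * p) := by
    have e1 : ∑ L, f L * (∑ a ∈ C, memInd a L) ^ 2 =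
        ∑ a ∈ C, ∑ b ∈ C, ∑ L, f L * (memInd a L * memInd b L) := by
      simp_rw [sq, Finset.sum_mul_sum, Finset.mul_sum]
      rw [Finset.sum_comm]
      exact Finset.sum_congr rfl fun a _ => Finset.sum_comm
    have e2 : ∀ a ∈ C, ∀ b ∈ C, ∑ L, f L * (memInd a L * memInd b L) ≤
        (if b = a then γ else 0) + p * γ := by
      intro a ha b hb
      split_ifs with h
      · subst h
        refine le_add_of_le_of_nonneg (le_of_eq ?_) (by positivity)
        rw [← heq b hb]
        refine Finset.sum_congr rfl fun L _ => ?_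
        unfold memInd; split_ifs <;> simp
      · rw [hpair a ha b hb h, heq a ha, zero_add]
    rw [e1]
    refine (Finset.sum_le_sum fun a ha => Finset.sum_le_sum fun b hb => e2 a ha b hb).trans_eq ?_
    simp_rw [Finset.sum_add_distrib, Finset.sum_const, nsmul_eq_mul]
    rw [Finset.sum_congr rfl fun a ha => by rw [Finset.sum_ite_eq' C a, if_pos ha],
      Finset.sum_const, nsmul_eq_mul]
    ring
  have hcs : (#C * γ) ^ 2 ≤ (∑ L, f L * (∑ a ∈ C, memInd a L) ^ 2) * ∑ L, f L := by
    rw [← hK]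
    refine Finset.sum_sq_le_sum_mul_sum_of_sq_le_mul _
      (fun L _ => mul_nonneg (hf0 L) (sq_nonneg _)) (fun L _ => hf0 L) fun L _ => le_of_eq (by ring)
  have hD0 : 0 ≤ ∑ L, f L := Finset.sum_nonneg fun L _ => hf0 L
  rcases hγ0.eq_or_lt with h | h
  · rw [← h]; positivity
  · have h3 := hcs.trans (mul_le_mul_of_nonneg_right hK2 hD0)
    have h4 : (#C * γ) * (#C * γ) ≤ (#C * γ) * ((1 + #C * p) * ∑ L, f L) := by linarith
    have h5 := le_of_mul_le_mul_left h4 (by positivity)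
    have h6 : (p + 1 / #C) * ∑ L, f L = ((1 + #C * p) * ∑ L, f L) / #C := by field_simp; ring
    rw [h6, le_div_iff₀ hc]
    linarith

theorem sum_condMoment_memInd_le [Fintype ξ] (h0 : 0 < p) (h1 : p ≤ 1) (C : Finset M)
    (hC : ∀ e ∈ C, ∀ f ∈ C, f ≠ e → ∀ L, e ∈ L → φ (L ∆ {f}) = φ L) :
    ∑ e ∈ C, condMoment p φ (memInd e) ≤ (p * #C + 1) * (p * (1 - p ^ 2) ^ Fintype.card M) := by
  have hw : 0 ≤ p * (1 - p ^ 2) ^ Fintype.card M :=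
    mul_nonneg h0.le (pow_nonneg (by nlinarith) _)
  have : ∀ e ∈ C, condMoment p φ (memInd e) ≤
      (p + 1 / #C) * (p * (1 - p ^ 2) ^ Fintype.card M) := fun e he =>
    (condMoment_le_mul φ h0.le h1 (memInd e) (memInd_nonneg e) (p + 1 / #C) (by positivity)
      (sum_patternWeight_mul_memInd_le_of_forall φ h0 h1 C hC he)).trans
      (mul_le_mul_of_nonneg_left (sum_memInd_mul_avoidProb_le h0.le h1 e) (by positivity))
  refine (Finset.sum_le_sum this).trans ?_
  rw [Finset.sum_const, nsmul_eq_mul, ← mul_assoc]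
  refine mul_le_mul_of_nonneg_right ?_ hw
  rcases C.eq_empty_or_nonempty with rfl | hne
  · simp
  · have hc : (0 : ℝ) < #C := by exact_mod_cast Finset.card_pos.2 hne
    exact le_of_eq (by field_simp)

theorem condMoment_memInd_le [Fintype ξ] (h0 : 0 ≤ p) (h1 : p ≤ 1)
    (hp : p * (Fintype.card M * p ^ 2) + p ≤ 1 / 2) (U : Finset M)
    (hφ : ∀ e ∉ U, ∀ L, φ (L ∆ {e}) = φ L) (e : M) :
    condMoment p φ (memInd e) ≤ 2 * (p * (1 - 2 * p ^ 2 + p ^ 3) ^ Fintype.card M +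
      p ^ 3 * (1 - p ^ 2) ^ Fintype.card M * #(U.erase e)) := by
  have hnn := condMoment_nonneg φ h0 h1 (memInd e)
  have hmain := condMoment_le_add φ h0 h1 (memInd e) (memInd_nonneg e) (memInd_le_one e)
  have hf : ∀ f, condMoment p φ (fun L => memInd e L * memInd f L) ≤
      p ^ 2 * condMoment p φ (memInd e) + ((if f = e then condMoment p φ (memInd e) else 0) +
        if f ∈ U.erase e then p ^ 2 * (1 - p ^ 2) ^ Fintype.card M else 0) := by
    intro f
    rcases eq_or_ne f e with rfl | hfe
    · have : (fun L => memInd f L * memInd f L) = memInd f := by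
        ext L; unfold memInd; split_ifs <;> simp
      rw [this]
      simp
      positivity
    · by_cases hfU : f ∈ U
      · simp only [hfe, if_false, Finset.mem_erase, hfU, ne_eq, not_false_eq_true, and_self,
          if_true, zero_add]
        refine le_add_of_nonneg_of_le (by positivity) ?_
        exact (condMoment_le φ h0 h1 _ (fun L => mul_nonneg (memInd_nonneg e L) (memInd_nonneg f L))
          (fun L => mul_le_one₀ (memInd_le_one e L) (memInd_nonneg f L) (memInd_le_one f L))).trans
          (sum_memInd_mul_memInd_mul_avoidProb_le h0 h1 hfe)
      · simp only [hfe, if_false, Finset.mem_erase, hfU, and_false, add_zero]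
        exact condMoment_mul_memInd_le φ h0 h1 _ (memInd_nonneg e) f (hφ f hfU)
          (memInd_symmDiff_singleton hfe.symm)
  have hsum := Finset.sum_le_sum fun f (_ : f ∈ Finset.univ) => hf f
  simp_rw [Finset.sum_add_distrib] at hsum
  rw [Finset.sum_const, Finset.card_univ, nsmul_eq_mul, Finset.sum_ite_eq' Finset.univ e,
    if_pos (Finset.mem_univ e), Finset.sum_ite_mem, Finset.univ_inter, Finset.sum_const,
    nsmul_eq_mul] at hsum
  have h2 := mul_le_mul_of_nonneg_left hsum h0
  have h3 := sum_memInd_mul_avoidProb_sq_le h0 h1 e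
  have h4 := mul_le_mul_of_nonneg_right hp hnn
  linarith

theorem condMoment_one_le [Fintype ξ] {J : Type*} [Fintype J] (h0 : 0 < p) (h1 : p ≤ 1)
    (hp : p * (Fintype.card M * p ^ 2) + p ≤ 1 / 2) (U : Finset M)
    (hφ : ∀ e ∉ U, ∀ L, φ (L ∆ {e}) = φ L) (C : J → Finset M)
    (hC : ∀ j, ∀ e ∈ C j, ∀ f ∈ C j, f ≠ e → ∀ L, e ∈ L → φ (L ∆ {f}) = φ L)
    (U₂ : Finset M) (hcov : ∀ e ∈ U, e ∈ U₂ ∨ ∃ j, e ∈ C j) :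
    condMoment p φ 1 ≤ (1 - 2 * p ^ 2 + p ^ 3) ^ Fintype.card M +
      p * (Fintype.card M * p ^ 2) * condMoment p φ 1 +
      p ^ 2 * (1 - p ^ 2) ^ Fintype.card M * (p * ∑ j, (#(C j) : ℝ) + Fintype.card J) +
      2 * p ^ 2 * (1 - 2 * p ^ 2 + p ^ 3) ^ Fintype.card M * #U₂ +
      2 * p ^ 4 * (1 - p ^ 2) ^ Fintype.card M * ∑ e ∈ U₂, (#(U.erase e) : ℝ) := by
  have hnn := fun g => condMoment_nonneg φ h0.le h1 g
  have hmain := condMoment_le_add φ h0.le h1 1 (by simp) (by simp)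
  have hone : ∀ e, condMoment p φ (fun L => (1 : Set M → ℝ) L * memInd e L) =
      condMoment p φ (memInd e) := by
    intro e; congr 1; ext L; simp
  simp_rw [hone] at hmain
  have hfirst : ∑ L : Set M, bernoulliWeight p L * ((1 : Set M → ℝ) L * avoidProb p L ^ 2) =
      (1 - 2 * p ^ 2 + p ^ 3) ^ Fintype.card M := by
    simp [sum_bernoulliWeight_mul_avoidProb_sq]
  have he : ∀ e, condMoment p φ (memInd e) ≤ p ^ 2 * condMoment p φ 1 +
      ((∑ j, if e ∈ C j then condMoment p φ (memInd e) else 0) +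
        if e ∈ U₂ then condMoment p φ (memInd e) else 0) := by
    intro e
    have hs0 : ∀ j, 0 ≤ if e ∈ C j then condMoment p φ (memInd e) else 0 := by
      intro j; split_ifs; exacts [hnn _, le_rfl]
    have hp2 : 0 ≤ p ^ 2 * condMoment p φ 1 := mul_nonneg (sq_nonneg _) (hnn _)
    by_cases heU : e ∈ U
    · refine le_add_of_nonneg_of_le hp2 ?_
      rcases hcov e heU with h | ⟨j, hj⟩
      · rw [if_pos h]
        exact le_add_of_nonneg_left (Finset.sum_nonneg fun j _ => hs0 j)
      · refine le_add_of_le_of_nonneg ?_ (by split_ifs; exacts [hnn _, le_rfl])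
        have := Finset.single_le_sum (fun j _ => hs0 j) (Finset.mem_univ j)
        rwa [if_pos hj] at this
    · refine le_add_of_le_of_nonneg ?_ (add_nonneg (Finset.sum_nonneg fun j _ => hs0 j)
        (by split_ifs; exacts [hnn _, le_rfl]))
      rw [← hone]
      exact condMoment_mul_memInd_le φ h0.le h1 1 (by simp) e (hφ e heU) (by simp)
  have hsum := Finset.sum_le_sum fun e (_ : e ∈ Finset.univ) => he e
  simp_rw [Finset.sum_add_distrib] at hsum
  rw [Finset.sum_const, Finset.card_univ, nsmul_eq_mul, Finset.sum_comm, Finset.sum_ite_mem,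
    Finset.univ_inter] at hsum
  simp_rw [Finset.sum_ite_mem, Finset.univ_inter] at hsum
  have hCs := Finset.sum_le_sum fun j (_ : j ∈ Finset.univ) =>
    sum_condMoment_memInd_le φ h0 h1 (C j) (hC j)
  rw [← Finset.sum_mul, Finset.sum_add_distrib, ← Finset.mul_sum, Finset.sum_const,
    Finset.card_univ, nsmul_eq_mul, mul_one] at hCs
  have hU₂ := Finset.sum_le_sum fun e (_ : e ∈ U₂) => condMoment_memInd_le φ h0.le h1 hp U hφ e
  rw [← Finset.mul_sum, Finset.sum_add_distrib, Finset.sum_const, nsmul_eq_mul,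
    ← Finset.mul_sum] at hU₂
  have h2 := mul_le_mul_of_nonneg_left (hsum.trans (add_le_add_right (add_le_add hCs hU₂) _)) h0.le
  rw [hfirst] at hmain
  refine hmain.trans ((add_le_add_right h2 _).trans_eq ?_)
  ring
end Pattern
end Weights

section Vertices
open scoped Classical Finset symmDiff

theorem disjoint_symmDiff_singleton_iff {M : Type*} {F : Set M} (L : Set M) {e : M} (he : e ∉ F) :
    Disjoint (L ∆ {e}) F ↔ Disjoint L F := by
  simp only [Set.disjoint_left]
  refine forall_congr' fun f => ?_
  rcases eq_or_ne f e with rfl | h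
  · simp [he]
  · simp [Set.mem_symmDiff, h]

/-- The indices `j` for which the section of `B` at `j` meets `L`. -/
def hitPattern {J M : Type*} (B : Set (J × M)) (L : Set M) : Set J :=
  {j | ¬ Disjoint L {e | (j, e) ∈ B}}

variable {J M : Type*} [Fintype J] [Fintype M] {p : ℝ}

theorem sum_bernoulliWeight_mul_memInd_one (h0 : 0 ≤ p) (h1 : p ≤ 1) (a : M) :
    ∑ B, bernoulliWeight p B * memInd a B = p := by
  have := sum_bernoulliWeight_mul_memInd h0 h1 a (fun _ => 1) (by simp)
  simpa [sum_bernoulliWeight] using this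

theorem sum_bernoulliWeight_mul_memInd_two (h0 : 0 ≤ p) (h1 : p ≤ 1) {a b : M} (hab : a ≠ b) :
    ∑ B, bernoulliWeight p B * (memInd a B * memInd b B) = p ^ 2 := by
  have := sum_bernoulliWeight_mul_memInd h0 h1 a (memInd b)
    (fun L _ => memInd_symmDiff_singleton hab.symm L)
  simp_rw [← mul_assoc]
  rw [this, sum_bernoulliWeight_mul_memInd_one h0 h1, sq]

theorem sum_bernoulliWeight_mul_memInd_three (h0 : 0 ≤ p) (h1 : p ≤ 1) {a b c : M} (hab : a ≠ b)
    (hac : a ≠ c) (hbc : b ≠ c) :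
    ∑ B, bernoulliWeight p B * (memInd a B * memInd b B * memInd c B) = p ^ 3 := by
  have := sum_bernoulliWeight_mul_memInd h0 h1 a (fun B => memInd b B * memInd c B)
    (fun L _ => by simp only [memInd_symmDiff_singleton hab.symm,
      memInd_symmDiff_singleton hac.symm])
  simp_rw [mul_assoc, ← mul_assoc (bernoulliWeight p _)]
  rw [this, sum_bernoulliWeight_mul_memInd_two h0 h1 hbc]
  ring

theorem condMoment_hitPattern_le (h0 : 0 < p) (h1 : p ≤ 1)
    (hp : p * (Fintype.card M * p ^ 2) + p ≤ 1 / 2) (B : Set (J × M)) :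
    condMoment p (hitPattern B) 1 ≤ (1 - 2 * p ^ 2 + p ^ 3) ^ Fintype.card M +
      p * (Fintype.card M * p ^ 2) * condMoment p (hitPattern B) 1 +
      p ^ 2 * (1 - p ^ 2) ^ Fintype.card M *
        (p * ∑ j : J, ∑ e, memInd (j, e) B + Fintype.card J) +
      2 * p ^ 2 * (1 - 2 * p ^ 2 + p ^ 3) ^ Fintype.card M *
        ∑ e, ∑ j : J, ∑ l ∈ Finset.univ.erase j, memInd (j, e) B * memInd (l, e) B +
      2 * p ^ 4 * (1 - p ^ 2) ^ Fintype.card M *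
        ∑ e, ∑ j : J, ∑ l ∈ Finset.univ.erase j, ∑ f ∈ Finset.univ.erase e, ∑ h : J,
          memInd (j, e) B * memInd (l, e) B * memInd (h, f) B := by
  have hw : 0 ≤ 1 - p ^ 2 := by nlinarith
  have ha : 0 ≤ 1 - 2 * p ^ 2 + p ^ 3 := by nlinarith [mul_nonneg (sub_nonneg.2 h1) h0.le]
  have hmem := fun a => memInd_nonneg a B
  have hmul := fun a b => mul_nonneg (hmem a) (hmem b)
  have hflip : ∀ e (j : J), (j, e) ∉ B → ∀ L,
      (j ∈ hitPattern B (L ∆ {e}) ↔ j ∈ hitPattern B L) := fun e j h L =>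
    not_congr (disjoint_symmDiff_singleton_iff L h)
  have hU₂ : ∀ e, (if ∃ j l, j ≠ l ∧ (j, e) ∈ B ∧ (l, e) ∈ B then (1 : ℝ) else 0) ≤
      ∑ j : J, ∑ l ∈ Finset.univ.erase j, memInd (j, e) B * memInd (l, e) B := by
    intro e
    split_ifs with h
    · obtain ⟨j, l, hjl, hj, hl⟩ := h
      refine le_trans ?_ (Finset.single_le_sum (fun j _ => Finset.sum_nonneg fun l _ => hmul _ _)
        (Finset.mem_univ j))
      refine le_trans ?_ (Finset.single_le_sum (fun l _ => hmul (j, e) (l, e))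
        (Finset.mem_erase.2 ⟨hjl.symm, Finset.mem_univ l⟩))
      simp [memInd, hj, hl]
    · exact Finset.sum_nonneg fun j _ => Finset.sum_nonneg fun l _ => hmul _ _
  have hU : ∀ f, (if ∃ h : J, (h, f) ∈ B then (1 : ℝ) else 0) ≤ ∑ h : J, memInd (h, f) B := by
    intro f
    split_ifs with h
    · obtain ⟨h, hh⟩ := h
      refine le_trans ?_ (Finset.single_le_sum (fun h _ => hmem (h, f)) (Finset.mem_univ h))
      simp [memInd, hh]
    · exact Finset.sum_nonneg fun h _ => hmem _
  refine (condMoment_one_le (hitPattern B) h0 h1 hp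
    (Finset.univ.filter fun e => ∃ j : J, (j, e) ∈ B) (fun e he L => ?_)
    (fun j => Finset.univ.filter fun e => (j, e) ∈ B ∧ ∀ l, l ≠ j → (l, e) ∉ B)
    (fun j e he f hf hfe L heL => ?_)
    (Finset.univ.filter fun e => ∃ j l, j ≠ l ∧ (j, e) ∈ B ∧ (l, e) ∈ B)
    (fun e he => ?_)).trans ?_
  · simp only [Finset.mem_filter, Finset.mem_univ, true_and, not_exists] at he
    ext j
    exact hflip e j (he j) L
  · simp only [Finset.mem_filter, Finset.mem_univ, true_and] at he hf
    ext l
    rcases eq_or_ne l j with rfl | hl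
    · have hL : ¬ Disjoint L {e | (l, e) ∈ B} := Set.not_disjoint_iff.2 ⟨e, heL, he.1⟩
      have hL' : ¬ Disjoint (L ∆ {f}) {e | (l, e) ∈ B} :=
        Set.not_disjoint_iff.2 ⟨e, by simp [Set.mem_symmDiff, heL, hfe.symm], he.1⟩
      exact iff_of_true hL' hL
    · exact hflip f l (hf.2 l hl) L
  · simp only [Finset.mem_filter, Finset.mem_univ, true_and] at he ⊢
    obtain ⟨j, hj⟩ := he
    by_cases h : ∀ l, l ≠ j → (l, e) ∉ B
    · exact Or.inr ⟨j, hj, h⟩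
    · push Not at h
      obtain ⟨l, hl, hlB⟩ := h
      exact Or.inl ⟨j, l, hl.symm, hj, hlB⟩
  · refine add_le_add (add_le_add (add_le_add_right ?_ _) ?_) ?_
    · refine mul_le_mul_of_nonneg_left (add_le_add_left (mul_le_mul_of_nonneg_left
        (Finset.sum_le_sum fun j _ => ?_) h0.le) _) (by positivity)
      rw [Finset.card_filter]
      push_cast
      refine Finset.sum_le_sum fun e _ => ?_
      unfold memInd
      split_ifs <;> simp_all
    · refine mul_le_mul_of_nonneg_left ?_ (by positivity)
      rw [Finset.card_filter]
      push_cast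
      exact Finset.sum_le_sum fun e _ => hU₂ e
    · refine mul_le_mul_of_nonneg_left ?_ (by positivity)
      rw [Finset.sum_filter]
      refine Finset.sum_le_sum fun e _ => ?_
      rw [← mul_boole]
      have hc : (#((Finset.univ.filter fun e => ∃ j : J, (j, e) ∈ B).erase e) : ℝ) ≤
          ∑ f ∈ Finset.univ.erase e, ∑ h : J, memInd (h, f) B := by
        rw [← Finset.filter_erase, Finset.card_filter]
        push_cast
        exact Finset.sum_le_sum fun f _ => hU f
      refine (mul_le_mul hc (hU₂ e) (by split_ifs <;> simp) (Finset.sum_nonneg fun f _ =>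
        Finset.sum_nonneg fun h _ => hmem _)).trans_eq ?_
      rw [mul_comm, Finset.sum_mul]
      refine Finset.sum_congr rfl fun j _ => ?_
      rw [Finset.sum_mul]
      refine Finset.sum_congr rfl fun l _ => ?_
      rw [Finset.mul_sum]
      exact Finset.sum_congr rfl fun f _ => Finset.mul_sum _ _ _

/-- The second moment of the conditional probability that two independent random sets are disjoint,
given one of them and its intersection pattern with further independent random sets. -/
noncomputable def pairMoment (J M : Type*) [Fintype J] [Fintype M] (p : ℝ) : ℝ :=
  ∑ B : Set (J × M), bernoulliWeight p B * condMoment p (hitPattern B) 1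

theorem pairMoment_le (h0 : 0 < p) (h1 : p ≤ 1)
    (hp : p * (Fintype.card M * p ^ 2) + p ≤ 1 / 2) {n : ℝ} (hn : (Fintype.card J : ℝ) ≤ n) :
    pairMoment J M p ≤ (1 - 2 * p ^ 2 + p ^ 3) ^ Fintype.card M +
      p * (Fintype.card M * p ^ 2) * pairMoment J M p +
      p ^ 2 * (1 - p ^ 2) ^ Fintype.card M * (n * (Fintype.card M * p ^ 2) + n) +
      2 * p ^ 2 * (1 - 2 * p ^ 2 + p ^ 3) ^ Fintype.card M * (n ^ 2 * (Fintype.card M * p ^ 2)) +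
      2 * p ^ 3 * (1 - p ^ 2) ^ Fintype.card M * (n ^ 3 * (Fintype.card M * p ^ 2) ^ 2) := by
  have hw : 0 ≤ 1 - p ^ 2 := by nlinarith
  have ha : 0 ≤ 1 - 2 * p ^ 2 + p ^ 3 := by nlinarith [mul_nonneg (sub_nonneg.2 h1) h0.le]
  have hn0 : 0 ≤ n := le_trans (Nat.cast_nonneg _) hn
  set m : ℝ := (Fintype.card M : ℝ) with hm
  set N : ℝ := (Fintype.card J : ℝ) with hN
  have hm0 : 0 ≤ m := Nat.cast_nonneg _
  have hN0 : 0 ≤ N := Nat.cast_nonneg _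
  have e1 : ∑ B : Set (J × M), bernoulliWeight p B * ∑ j : J, ∑ e, memInd (j, e) B =
      N * (m * p) := by
    simp_rw [Finset.mul_sum]
    rw [Finset.sum_comm]
    simp_rw [Finset.sum_comm (s := (Finset.univ : Finset (Set (J × M)))),
      sum_bernoulliWeight_mul_memInd_one h0.le h1]
    simp [hN, hm]
  have e2 : ∑ B : Set (J × M), bernoulliWeight p B *
      ∑ e, ∑ j : J, ∑ l ∈ Finset.univ.erase j, memInd (j, e) B * memInd (l, e) B ≤
      m * (N * (N * p ^ 2)) := by
    simp_rw [Finset.mul_sum]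
    simp_rw [Finset.sum_comm (s := (Finset.univ : Finset (Set (J × M))))]
    refine (Finset.sum_le_card_nsmul _ _ (N * (N * p ^ 2)) fun e _ => ?_).trans_eq (by simp [hm])
    refine (Finset.sum_le_card_nsmul _ _ (N * p ^ 2) fun j _ => ?_).trans_eq (by simp [hN])
    rw [Finset.sum_congr rfl fun l hl => sum_bernoulliWeight_mul_memInd_two h0.le h1
      (a := (j, e)) (b := (l, e)) (by simpa using (Finset.mem_erase.1 hl).1.symm),
      Finset.sum_const, nsmul_eq_mul]
    exact mul_le_mul_of_nonneg_right (Nat.cast_le.2 (Finset.card_le_univ _)) (by positivity)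
  have e3 : ∑ B : Set (J × M), bernoulliWeight p B *
      ∑ e, ∑ j : J, ∑ l ∈ Finset.univ.erase j, ∑ f ∈ Finset.univ.erase e, ∑ h : J,
        memInd (j, e) B * memInd (l, e) B * memInd (h, f) B ≤
      m * (N * (N * (m * (N * p ^ 3)))) := by
    simp_rw [Finset.mul_sum]
    simp_rw [Finset.sum_comm (s := (Finset.univ : Finset (Set (J × M))))]
    refine (Finset.sum_le_card_nsmul _ _ (N * (N * (m * (N * p ^ 3)))) fun e _ => ?_).trans_eq
      (by simp [hm])
    refine (Finset.sum_le_card_nsmul _ _ (N * (m * (N * p ^ 3))) fun j _ => ?_).trans_eq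
      (by simp [hN])
    have hinner : ∀ l ∈ Finset.univ.erase j, ∀ f ∈ Finset.univ.erase e, ∀ h : J,
        ∑ B, bernoulliWeight p B * (memInd (j, e) B * memInd (l, e) B * memInd (h, f) B) =
          p ^ 3 := by
      intro l hl f hf h
      have hfe := (Finset.mem_erase.1 hf).1
      exact sum_bernoulliWeight_mul_memInd_three h0.le h1
        (by simpa using (Finset.mem_erase.1 hl).1.symm) (by simp [hfe.symm]) (by simp [hfe.symm])
    rw [Finset.sum_congr rfl fun l hl => Finset.sum_congr rfl fun f hf =>
      Finset.sum_congr rfl fun h _ => hinner l hl f hf h]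
    simp only [Finset.sum_const, nsmul_eq_mul, Finset.card_univ]
    gcongr
    · exact Nat.cast_le.2 (Finset.card_le_univ _)
    · exact Nat.cast_le.2 (Finset.card_le_univ _)
  have hsum := Finset.sum_le_sum fun (B : Set (J × M)) (_ : B ∈ Finset.univ) =>
    mul_le_mul_of_nonneg_left (condMoment_hitPattern_le h0 h1 hp B)
      (bernoulliWeight_nonneg h0.le h1 B)
  have hexp : ∑ B : Set (J × M), bernoulliWeight p B *
      ((1 - 2 * p ^ 2 + p ^ 3) ^ Fintype.card M + p * (m * p ^ 2) * condMoment p (hitPattern B) 1 +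
      p ^ 2 * (1 - p ^ 2) ^ Fintype.card M *
        (p * ∑ j : J, ∑ e, memInd (j, e) B + N) +
      2 * p ^ 2 * (1 - 2 * p ^ 2 + p ^ 3) ^ Fintype.card M *
        ∑ e, ∑ j : J, ∑ l ∈ Finset.univ.erase j, memInd (j, e) B * memInd (l, e) B +
      2 * p ^ 4 * (1 - p ^ 2) ^ Fintype.card M *
        ∑ e, ∑ j : J, ∑ l ∈ Finset.univ.erase j, ∑ f ∈ Finset.univ.erase e, ∑ h : J,
          memInd (j, e) B * memInd (l, e) B * memInd (h, f) B) =
      (1 - 2 * p ^ 2 + p ^ 3) ^ Fintype.card M + p * (m * p ^ 2) * pairMoment J M p +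
      p ^ 2 * (1 - p ^ 2) ^ Fintype.card M * (p * (N * (m * p)) + N) +
      2 * p ^ 2 * (1 - 2 * p ^ 2 + p ^ 3) ^ Fintype.card M *
        (∑ B : Set (J × M), bernoulliWeight p B *
          ∑ e, ∑ j : J, ∑ l ∈ Finset.univ.erase j, memInd (j, e) B * memInd (l, e) B) +
      2 * p ^ 4 * (1 - p ^ 2) ^ Fintype.card M *
        (∑ B : Set (J × M), bernoulliWeight p B *
          ∑ e, ∑ j : J, ∑ l ∈ Finset.univ.erase j, ∑ f ∈ Finset.univ.erase e, ∑ h : J,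
            memInd (j, e) B * memInd (l, e) B * memInd (h, f) B) := by
    rw [← e1]
    have hb := sum_bernoulliWeight (M := J × M) p
    have lin : ∀ (a c₁ c₂ c₃ c₄ : ℝ) (R F G H : Set (J × M) → ℝ),
        ∑ B, bernoulliWeight p B * (a + c₁ * R B + c₂ * (p * F B + N) + c₃ * G B + c₄ * H B) =
          a + c₁ * ∑ B, bernoulliWeight p B * R B +
            c₂ * (p * ∑ B, bernoulliWeight p B * F B + N) +
            c₃ * ∑ B, bernoulliWeight p B * G B + c₄ * ∑ B, bernoulliWeight p B * H B := by
      intro a c₁ c₂ c₃ c₄ R F G H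
      rw [Finset.sum_congr rfl fun B _ => show _ = (a + c₂ * N) * bernoulliWeight p B +
        c₁ * (bernoulliWeight p B * R B) + c₂ * p * (bernoulliWeight p B * F B) +
        c₃ * (bernoulliWeight p B * G B) + c₄ * (bernoulliWeight p B * H B) by ring]
      simp only [Finset.sum_add_distrib, ← Finset.mul_sum, hb]
      ring
    exact lin _ _ _ _ _ _ _ _ _
  have := hsum.trans_eq hexp
  refine this.trans ?_
  refine add_le_add (add_le_add (add_le_add_right ?_ _) ?_) ?_
  · have : p * (N * (m * p)) + N = N * (m * p ^ 2) + N := by ring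
    rw [this]
    gcongr
  · refine mul_le_mul_of_nonneg_left (e2.trans ?_) (by positivity)
    have : m * (N * (N * p ^ 2)) = N ^ 2 * (m * p ^ 2) := by ring
    rw [this]
    gcongr
  · refine (mul_le_mul_of_nonneg_left e3 (by positivity)).trans ?_
    have : 2 * p ^ 4 * (1 - p ^ 2) ^ Fintype.card M * (m * (N * (N * (m * (N * p ^ 3))))) =
        2 * p ^ 3 * (1 - p ^ 2) ^ Fintype.card M * (N ^ 3 * (m * p ^ 2) ^ 2) := by ring
    rw [this]
    gcongr
end Vertices

section Splitting
open scoped Classical Finset symmDiff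

variable {V M : Type*}

/-- The sets of the vertices other than `k` and `i`, as a single set. -/
def otherSets (k i : V) (ω : V → Set M) : Set ({j : V // j ≠ k ∧ j ≠ i} × M) :=
  {x | x.2 ∈ ω x.1}

/-- Splitting off the sets of two vertices. -/
noncomputable def splitEquiv {k i : V} (hki : k ≠ i) :
    (V → Set M) ≃ Set M × Set M × Set ({j : V // j ≠ k ∧ j ≠ i} × M) where
  toFun ω := (ω k, ω i, otherSets k i ω)
  invFun t v := if hk : v = k then t.1 else if hi : v = i then t.2.1 else
    {e | (⟨v, hk, hi⟩, e) ∈ t.2.2}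
  left_inv ω := by
    ext v e
    by_cases hk : v = k
    · subst hk; simp
    · by_cases hi : v = i
      · subst hi; simp [hk]
      · simp [hk, hi, otherSets]
  right_inv t := by
    obtain ⟨L, A, B⟩ := t
    simp only [dite_true, hki.symm, dite_false, Prod.mk.injEq, true_and]
    ext ⟨⟨v, hk, hi⟩, e⟩
    simp [otherSets, hk, hi]

theorem mk_notMem_edgeSet_intersectionGraph {k i : V} (hki : k ≠ i) (ω : V → Set M) :
    s(k, i) ∉ (intersectionGraph ω).edgeSet ↔ Disjoint (ω k) (ω i) := by
  simp [intersectionGraph, hki, Set.not_nonempty_iff_eq_empty, Set.disjoint_iff_inter_eq_empty]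

variable [Fintype V] [Fintype M] {p : ℝ}

/-- The weight of a family of independent random sets. -/
noncomputable def setsWeight (p : ℝ) (ω : V → Set M) : ℝ := ∏ v, bernoulliWeight p (ω v)

theorem setsWeight_nonneg (h0 : 0 ≤ p) (h1 : p ≤ 1) (ω : V → Set M) : 0 ≤ setsWeight p ω :=
  Finset.prod_nonneg fun v _ => bernoulliWeight_nonneg h0 h1 (ω v)

variable [DecidableEq V]

theorem setsWeight_eq {k i : V} (hki : k ≠ i) (ω : V → Set M) :
    setsWeight p ω = bernoulliWeight p (ω k) * (bernoulliWeight p (ω i) *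
      bernoulliWeight p (otherSets k i ω)) := by
  have h : bernoulliWeight p (otherSets k i ω) =
      ∏ j : {j : V // j ≠ k ∧ j ≠ i}, bernoulliWeight p (ω j) := by
    simp only [bernoulliWeight, Fintype.prod_prod_type]
    rfl
  rw [h, setsWeight, ← Finset.mul_prod_erase _ _ (Finset.mem_univ k),
    ← Finset.mul_prod_erase _ _ (Finset.mem_erase.2 ⟨hki.symm, Finset.mem_univ i⟩)]
  congr 2
  refine Finset.prod_subtype _ (fun j => ?_) fun j => bernoulliWeight p (ω j)
  simp [and_comm]

theorem sum_setsWeight_mul {k i : V} (hki : k ≠ i)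
    (G : Set M → Set M → Set ({j : V // j ≠ k ∧ j ≠ i} × M) → ℝ) :
    ∑ ω : V → Set M, setsWeight p ω * G (ω k) (ω i) (otherSets k i ω) =
      ∑ B, bernoulliWeight p B * ∑ A, bernoulliWeight p A * ∑ L, bernoulliWeight p L * G L A B := by
  simp_rw [setsWeight_eq hki]
  refine ((splitEquiv hki).sum_comp fun t => bernoulliWeight p t.1 * (bernoulliWeight p t.2.1 *
    bernoulliWeight p t.2.2) * G t.1 t.2.1 t.2.2).trans ?_
  rw [Fintype.sum_prod_type, Finset.sum_comm, Fintype.sum_prod_type_right]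
  refine Finset.sum_congr rfl fun B _ => ?_
  rw [Finset.mul_sum]
  refine Finset.sum_congr rfl fun A _ => ?_
  rw [Finset.mul_sum, Finset.mul_sum]
  exact Finset.sum_congr rfl fun L _ => by ring

theorem sum_setsWeight : ∑ ω : V → Set M, setsWeight p ω = 1 := by
  have := (Fintype.prod_sum fun (_ : V) (L : Set M) => bernoulliWeight p L).symm
  simpa [setsWeight, sum_bernoulliWeight] using this

theorem sum_setsWeight_notMem {k i : V} (hki : k ≠ i) :
    ∑ ω : V → Set M with s(k, i) ∉ (intersectionGraph ω).edgeSet, setsWeight p ω =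
      (1 - p ^ 2) ^ Fintype.card M := by
  rw [Finset.sum_filter]
  have := sum_setsWeight_mul (p := p) (M := M) hki fun L A _ => disjInd L A
  rw [← Finset.sum_mul, sum_bernoulliWeight, one_mul] at this
  refine Eq.trans (Finset.sum_congr rfl fun ω _ => ?_) (this.trans ?_)
  · rw [← mul_boole]
    congr 1
    simp only [mk_notMem_edgeSet_intersectionGraph hki, disjInd]
  · rw [← sum_bernoulliWeight_mul_avoidProb]
    refine Finset.sum_congr rfl fun A _ => ?_
    simp_rw [disjInd_comm _ A, sum_bernoulliWeight_mul_disjInd]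

theorem sum_cellMassNot_intersectionGraph_le (h0 : 0 ≤ p) (h1 : p ≤ 1) {k i : V} (hki : k ≠ i)
    (S : Finset (Sym2 V)) (hS : s(k, i) ∉ S) :
    ∑ y ∈ S.powerset,
      cellMassNot (setsWeight p) (fun ω : V → Set M => (intersectionGraph ω).edgeSet) S y s(k, i)
        ^ 2 / cellMass (setsWeight p) (fun ω : V → Set M => (intersectionGraph ω).edgeSet) S y ≤
      pairMoment {j : V // j ≠ k ∧ j ≠ i} M p := by
  refine (sum_cellMassNot_sq_div_le (setsWeight p) (setsWeight_nonneg h0 h1) _ S s(k, i)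
    (fun ω => (otherSets k i ω, hitPattern (otherSets k i ω) (ω k), ω i))
    fun ω ω' hD f hf => ?_).trans_eq ?_
  · simp only [Prod.mk.injEq] at hD
    obtain ⟨hB, hP, hi⟩ := hD
    have hother : ∀ j, j ≠ k → ω j = ω' j := by
      intro j hj
      rcases eq_or_ne j i with rfl | hji
      · exact hi
      · ext e
        have := Set.ext_iff.1 hB (⟨j, hj, hji⟩, e)
        simpa [otherSets] using this
    have hk : ∀ j, j ≠ k → j ≠ i → (Disjoint (ω k) (ω j) ↔ Disjoint (ω' k) (ω' j)) := by
      intro j hj hji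
      have := Set.ext_iff.1 hP ⟨j, hj, hji⟩
      simpa [hitPattern, otherSets, not_iff_not] using this
    have hadj : ∀ a b, s(a, b) ≠ s(k, i) →
        (s(a, b) ∈ (intersectionGraph ω).edgeSet ↔ s(a, b) ∈ (intersectionGraph ω').edgeSet) := by
      intro a b hne
      rcases eq_or_ne a b with rfl | hab
      · simp
      rw [← not_iff_not, mk_notMem_edgeSet_intersectionGraph hab,
        mk_notMem_edgeSet_intersectionGraph hab]
      rcases eq_or_ne a k with rfl | ha
      · exact hk b hab.symm fun h => hne (h ▸ rfl)
      · rcases eq_or_ne b k with rfl | hb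
        · rw [disjoint_comm, disjoint_comm (a := ω' a)]
          exact hk a ha fun h => hne (h ▸ Sym2.eq_swap)
        · rw [hother a ha, hother b hb]
    induction f using Sym2.ind with
    | _ a b => exact hadj a b fun h => hS (h ▸ hf)
  · have hnum : ∀ (B : Set ({j : V // j ≠ k ∧ j ≠ i} × M)) x A,
        ∑ ω : V → Set M with (otherSets k i ω, hitPattern (otherSets k i ω) (ω k), ω i) =
          (B, x, A) ∧ s(k, i) ∉ (intersectionGraph ω).edgeSet, setsWeight p ω =
        bernoulliWeight p B * (bernoulliWeight p A *
          ∑ L, patternWeight p (hitPattern B) x L * disjInd L A) := by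
      intro B x A
      have := sum_setsWeight_mul (p := p) (M := M) hki fun L A' B' =>
        if B' = B then if A' = A then if hitPattern B' L = x then disjInd L A' else 0 else 0 else 0
      rw [Finset.sum_filter]
      refine Eq.trans (Finset.sum_congr rfl fun ω _ => ?_) (this.trans ?_)
      · rw [← mul_boole]
        congr 1
        simp only [mk_notMem_edgeSet_intersectionGraph hki, disjInd, Prod.mk.injEq]
        split_ifs <;> simp_all
      · rw [Finset.sum_eq_single B (fun B' _ h => by simp [h]) (by simp),
          Finset.sum_eq_single A (fun A' _ h => by simp [h]) (by simp)]
        congr 2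
        refine Finset.sum_congr rfl fun L _ => ?_
        simp [patternWeight]
    have hden : ∀ (B : Set ({j : V // j ≠ k ∧ j ≠ i} × M)) x A,
        ∑ ω : V → Set M with (otherSets k i ω, hitPattern (otherSets k i ω) (ω k), ω i) =
          (B, x, A), setsWeight p ω =
        bernoulliWeight p B * (bernoulliWeight p A *
          ∑ L, patternWeight p (hitPattern B) x L) := by
      intro B x A
      have := sum_setsWeight_mul (p := p) (M := M) hki fun L A' B' =>
        if B' = B then if A' = A then if hitPattern B' L = x then 1 else 0 else 0 else 0
      rw [Finset.sum_filter]
      refine Eq.trans (Finset.sum_congr rfl fun ω _ => ?_) (this.trans ?_)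
      · rw [← mul_boole]
        congr 1
        simp only [Prod.mk.injEq]
        split_ifs <;> simp_all
      · rw [Finset.sum_eq_single B (fun B' _ h => by simp [h]) (by simp),
          Finset.sum_eq_single A (fun A' _ h => by simp [h]) (by simp)]
        congr 2
        refine Finset.sum_congr rfl fun L _ => ?_
        simp [patternWeight]
    rw [Fintype.sum_prod_type, pairMoment]
    refine Finset.sum_congr rfl fun B _ => ?_
    rw [Fintype.sum_prod_type, condMoment, Finset.mul_sum]
    refine Finset.sum_congr rfl fun x _ => ?_
    rw [Finset.sum_div, Finset.mul_sum]
    refine Finset.sum_congr rfl fun A _ => ?_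
    refine (congrArg₂ (fun a b : ℝ => a ^ 2 / b) (Eq.trans (by congr!) (hnum B x A))
      (Eq.trans (by congr!) (hden B x A))).trans ?_
    simp only [Pi.one_apply, mul_one]
    generalize bernoulliWeight p B = b
    generalize bernoulliWeight p A = a
    generalize ∑ L, patternWeight p (hitPattern B) x L = D
    rcases eq_or_ne b 0 with rfl | hb
    · simp
    rcases eq_or_ne a 0 with rfl | ha
    · simp
    rcases eq_or_ne D 0 with rfl | hD
    · simp
    field_simp

theorem sum_abs_cellMass_intersectionGraph_sub_le (h0 : 0 ≤ p) (h1 : p ≤ 1) (ε w : ℝ)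
    (hw : w = (1 - p ^ 2) ^ Fintype.card M) (hw0 : 0 < w) (hw1 : w < 1)
    (hε : ∀ k i : V, k ≠ i → pairMoment {j : V // j ≠ k ∧ j ≠ i} M p ≤ w ^ 2 + ε * (w * (1 - w))) :
    ∑ y ∈ (Finset.univ.filter fun e : Sym2 V => ¬ e.IsDiag).powerset,
      |cellMass (setsWeight p) (fun ω : V → Set M => (intersectionGraph ω).edgeSet)
        (Finset.univ.filter fun e : Sym2 V => ¬ e.IsDiag) y -
          (1 - w) ^ #y * w ^ ((Fintype.card V).choose 2 - #y)| ≤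
      2 * √((Fintype.card V).choose 2 * ε) := by
  have hcard : #(Finset.univ.filter fun e : Sym2 V => ¬ e.IsDiag) = (Fintype.card V).choose 2 := by
    rw [← Sym2.card_subtype_not_diag, Fintype.card_subtype]
  have := sum_abs_cellMass_sub_le (setsWeight p) (setsWeight_nonneg h0 h1) sum_setsWeight
    (fun ω : V → Set M => (intersectionGraph ω).edgeSet) w ε hw0 hw1
    (Finset.univ.filter fun e : Sym2 V => ¬ e.IsDiag) (fun e he => ?_) fun e he S _ heS => ?_
  · rwa [hcard] at this
  · rw [Finset.mem_filter] at he
    induction e using Sym2.ind with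
    | _ k i => exact (sum_setsWeight_notMem (by simpa using he.2)).trans hw.symm
  · rw [Finset.mem_filter] at he
    induction e using Sym2.ind with
    | _ k i =>
      have hki : k ≠ i := by simpa using he.2
      exact (sum_cellMassNot_intersectionGraph_le h0 h1 hki S heS).trans (hε k i hki)
end Splitting

section Laws
open scoped Classical Finset

instance measurableSingletonClass_simpleGraph {V : Type*} [Countable V] :
    MeasurableSingletonClass (SimpleGraph V) where
  measurableSet_singleton G := by
    have := SimpleGraph.measurable_edgeSet (measurableSet_singleton G.edgeSet)
    convert this using 1
    ext H
    simp

theorem randomSets_real_singleton (n m : ℕ) (p : I) (ω : Fin n → Set (Fin m)) :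
    (randomSets n m p).real {ω} = setsWeight (p : ℝ) ω := by
  rw [measureReal_def, randomSets, Measure.pi_singleton, ENNReal.toReal_prod, setsWeight]
  refine Finset.prod_congr rfl fun v _ => ?_
  rw [← measureReal_def, setBernoulli_real_singleton p (Set.subset_univ _) Set.finite_univ,
    bernoulliWeight, Finset.prod_ite, Finset.prod_const, Finset.prod_const,
    Set.ncard_eq_toFinset_card', Set.ncard_eq_toFinset_card']
  congr 3 <;> ext e <;> simp

theorem randomIntersectionGraph_real (n m : ℕ) (p : I) (T : Set (SimpleGraph (Fin n))) :
    (randomIntersectionGraph n m p).real T =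
      ∑ ω : Fin n → Set (Fin m) with intersectionGraph ω ∈ T, setsWeight (p : ℝ) ω := by
  rw [randomIntersectionGraph, map_measureReal_apply (measurable_intersectionGraph n m)
    T.toFinite.measurableSet]
  simp_rw [← randomSets_real_singleton]
  rw [sum_measureReal_singleton]
  congr 1
  ext ω
  simp

theorem binomialRandom_real_singleton (n : ℕ) (q : I) (G : SimpleGraph (Fin n)) :
    (SimpleGraph.binomialRandom (Fin n) q).real {G} =
      (q : ℝ) ^ G.edgeSet.ncard * (1 - q : ℝ) ^ (n.choose 2 - G.edgeSet.ncard) := by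
  rw [measureReal_def, SimpleGraph.binomialRandom_singleton]
  simp

theorem tvDist_le_add_compl {α : Type*} [Fintype α] [MeasurableSpace α]
    [MeasurableSingletonClass α] (μ ν : Measure α) [IsProbabilityMeasure μ]
    [IsProbabilityMeasure ν] (a : α) :
    tvDist μ ν ≤ (1 - μ.real {a}) + (1 - ν.real {a}) := by
  have hsum : ∀ (ρ : Measure α) [IsProbabilityMeasure ρ],
      ∑ b ∈ Finset.univ.erase a, ρ.real {b} = 1 - ρ.real {a} := by
    intro ρ _
    have h1 : ∑ b, ρ.real {b} = 1 := by
      rw [sum_measureReal_singleton]; simp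
    rw [← h1, ← Finset.add_sum_erase _ _ (Finset.mem_univ a)]
    ring
  have hrest : ∑ b ∈ Finset.univ.erase a, |μ.real {b} - ν.real {b}| ≤
      (1 - μ.real {a}) + (1 - ν.real {a}) := by
    rw [← hsum μ, ← hsum ν, ← Finset.sum_add_distrib]
    refine Finset.sum_le_sum fun b _ => (abs_sub _ _).trans_eq ?_
    rw [abs_of_nonneg measureReal_nonneg, abs_of_nonneg measureReal_nonneg]
  have hμ : μ.real {a} ≤ 1 := measureReal_le_one
  have hν : ν.real {a} ≤ 1 := measureReal_le_one
  have ha : |μ.real {a} - ν.real {a}| ≤ (1 - μ.real {a}) + (1 - ν.real {a}) := by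
    rw [abs_le]; constructor <;> linarith
  rw [tvDist, ← Finset.add_sum_erase _ _ (Finset.mem_univ a)]
  linarith

/-- The non-loops of `Fin n`. -/
noncomputable def nonLoops (n : ℕ) : Finset (Sym2 (Fin n)) :=
  Finset.univ.filter fun e => ¬ e.IsDiag

theorem sum_simpleGraph_eq (n : ℕ) (F : Finset (Sym2 (Fin n)) → ℝ) :
    ∑ G : SimpleGraph (Fin n), F G.edgeSet.toFinset = ∑ y ∈ (nonLoops n).powerset, F y := by
  refine Finset.sum_bij (fun G _ => G.edgeSet.toFinset) (fun G _ => ?_) (fun G _ H _ h => ?_)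
    (fun y hy => ?_) fun G _ => rfl
  · rw [Finset.mem_powerset]
    intro e he
    simp only [nonLoops, Finset.mem_filter, Finset.mem_univ, true_and]
    exact G.not_isDiag_of_mem_edgeSet (by simpa using he)
  · exact SimpleGraph.edgeSet_injective (Set.toFinset_inj.1 h)
  · rw [Finset.mem_powerset] at hy
    refine ⟨SimpleGraph.fromEdgeSet y, Finset.mem_univ _, ?_⟩
    ext e
    have : e ∈ y → ¬ e.IsDiag := fun he => (Finset.mem_filter.1 (hy he)).2
    simp only [Set.mem_toFinset, SimpleGraph.edgeSet_fromEdgeSet, Set.mem_sdiff, Finset.mem_coe]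
    exact ⟨fun h => h.1, fun h => ⟨h, this h⟩⟩

theorem tvDist_eq_sum_cellMass (n m : ℕ) (p : I) :
    tvDist (randomIntersectionGraph n m p)
      (SimpleGraph.binomialRandom (Fin n) (edgeProb m p)) =
    (1 / 2) * ∑ y ∈ (nonLoops n).powerset, |cellMass (setsWeight (p : ℝ))
      (fun ω : Fin n → Set (Fin m) => (intersectionGraph ω).edgeSet) (nonLoops n) y -
      (1 - (1 - (p : ℝ) ^ 2) ^ m) ^ #y * ((1 - (p : ℝ) ^ 2) ^ m) ^ (n.choose 2 - #y)| := by
  rw [← sum_simpleGraph_eq n (fun y => |cellMass (setsWeight (p : ℝ))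
      (fun ω : Fin n → Set (Fin m) => (intersectionGraph ω).edgeSet) (nonLoops n) y -
      (1 - (1 - (p : ℝ) ^ 2) ^ m) ^ #y * ((1 - (p : ℝ) ^ 2) ^ m) ^ (n.choose 2 - #y)|), tvDist]
  congr 1
  refine Finset.sum_congr rfl fun G _ => ?_
  rw [randomIntersectionGraph_real, binomialRandom_real_singleton, cellMass,
    Set.ncard_eq_toFinset_card']
  have hq : (1 - (edgeProb m p : ℝ)) = (1 - (p : ℝ) ^ 2) ^ m := by
    simp [edgeProb]
  rw [hq]
  congr 3
  · congr 1
    ext ω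
    simp only [Set.mem_singleton_iff, Finset.mem_filter, Finset.mem_univ, true_and,
      Set.mem_toFinset, nonLoops]
    constructor
    · rintro rfl f _; rfl
    · intro h
      refine SimpleGraph.edgeSet_injective (Set.ext fun f => ?_)
      by_cases hf : f.IsDiag
      · exact iff_of_false (fun h' => SimpleGraph.not_isDiag_of_mem_edgeSet _ h' hf)
          fun h' => SimpleGraph.not_isDiag_of_mem_edgeSet _ h' hf
      · exact h f hf

theorem card_nonLoops (n : ℕ) : #(nonLoops n) = n.choose 2 := by
  rw [nonLoops, ← Fintype.card_subtype, Sym2.card_subtype_not_diag, Fintype.card_fin]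

theorem tvDist_le_choose_mul (n m : ℕ) (p : I) :
    tvDist (randomIntersectionGraph n m p)
      (SimpleGraph.binomialRandom (Fin n) (edgeProb m p)) ≤
    2 * (n.choose 2 * (1 - (p : ℝ) ^ 2) ^ m) := by
  set w : ℝ := (1 - (p : ℝ) ^ 2) ^ m with hw
  have hq : (edgeProb m p : ℝ) = 1 - w := rfl
  have hq0 := (edgeProb m p).2.1
  have hν : 1 - (SimpleGraph.binomialRandom (Fin n) (edgeProb m p)).real {⊤} ≤
      n.choose 2 * w := by
    have hc : (⊤ : SimpleGraph (Fin n)).edgeSet.ncard = n.choose 2 := by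
      rw [← card_nonLoops, ← Set.ncard_coe_finset]
      congr 1
      ext e
      simp [nonLoops]
    rw [binomialRandom_real_singleton, hc, Nat.sub_self, pow_zero, mul_one, hq]
    have := one_add_mul_le_pow (a := -w) (by rw [hq] at hq0; linarith) (n.choose 2)
    rw [sub_eq_add_neg 1 w]
    linarith
  have hμ : 1 - (randomIntersectionGraph n m p).real {⊤} ≤ n.choose 2 * w := by
    have hP := setsWeight_nonneg (V := Fin n) (M := Fin m) p.2.1 p.2.2
    have hpt : ∀ ω : Fin n → Set (Fin m),
        setsWeight (p : ℝ) ω ≤ (if intersectionGraph ω = ⊤ then setsWeight (p : ℝ) ω else 0) +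
          ∑ e ∈ nonLoops n, if e ∉ (intersectionGraph ω).edgeSet then setsWeight (p : ℝ) ω
            else 0 := by
      intro ω
      have hnn : ∀ e ∈ nonLoops n,
          0 ≤ if e ∉ (intersectionGraph ω).edgeSet then setsWeight (p : ℝ) ω else 0 := by
        intro e _; split_ifs
        · exact le_rfl
        · exact hP ω
      split_ifs with h
      · exact le_add_of_nonneg_right (Finset.sum_nonneg hnn)
      · obtain ⟨e, he, heω⟩ : ∃ e ∈ nonLoops n, e ∉ (intersectionGraph ω).edgeSet := by
          by_contra! hcon
          refine h (SimpleGraph.edgeSet_injective (Set.ext fun e => ?_))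
          simp only [nonLoops, Finset.mem_filter, Finset.mem_univ, true_and] at hcon
          exact ⟨fun he => by simpa using SimpleGraph.not_isDiag_of_mem_edgeSet _ he,
            fun he => hcon e (by simpa using he)⟩
        have := Finset.single_le_sum hnn he
        rw [if_pos heω] at this
        linarith
    have hsum := Finset.sum_le_sum fun ω (_ : ω ∈ Finset.univ) => hpt ω
    rw [sum_setsWeight, Finset.sum_add_distrib, Finset.sum_comm] at hsum
    have hedge : ∀ e ∈ nonLoops n, ∑ ω : Fin n → Set (Fin m),
        (if e ∉ (intersectionGraph ω).edgeSet then setsWeight (p : ℝ) ω else 0) = w := by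
      intro e he
      rw [nonLoops, Finset.mem_filter] at he
      rw [← Finset.sum_filter]
      induction e using Sym2.ind with
      | _ k i =>
        have := sum_setsWeight_notMem (M := Fin m) (p := (p : ℝ)) (k := k) (i := i)
          (by simpa using he.2)
        rwa [Fintype.card_fin] at this
    rw [Finset.sum_congr rfl hedge, Finset.sum_const, card_nonLoops, nsmul_eq_mul,
      ← Finset.sum_filter] at hsum
    rw [randomIntersectionGraph_real]
    simp only [Set.mem_singleton_iff]
    linarith
  linarith [tvDist_le_add_compl (randomIntersectionGraph n m p)
    (SimpleGraph.binomialRandom (Fin n) (edgeProb m p)) ⊤]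

theorem tvDist_eq_zero_of_eq_zero (n m : ℕ) :
    tvDist (randomIntersectionGraph n m 0)
      (SimpleGraph.binomialRandom (Fin n) (edgeProb m 0)) = 0 := by
  have h : edgeProb m 0 = 0 := by ext; simp [edgeProb]
  have h2 : randomIntersectionGraph n m 0 = Measure.dirac ⊥ := by
    rw [randomIntersectionGraph, randomSets]
    simp only [setBernoulli_zero]
    rw [← Measure.infinitePi_eq_pi, Measure.infinitePi_dirac,
      Measure.map_dirac' (measurable_intersectionGraph n m)]
    congr 1
    ext i j
    simp [intersectionGraph]
  rw [h, SimpleGraph.binomialRandom_zero, h2]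
  simp [tvDist]
end Laws

section Analysis

theorem pow_one_sub_sq_mul_le {p : ℝ} (h0 : 0 ≤ p) (h1 : p ≤ 1) (m : ℕ) :
    (1 - p ^ 2) ^ m * (1 + m * p ^ 2 + (m * p ^ 2) ^ 2 / 2) ≤ 1 := by
  have h2 : (1 - p ^ 2) ^ m ≤ Real.exp (-(m * p ^ 2)) := by
    have := pow_le_pow_left₀ (by nlinarith) (Real.one_sub_le_exp_neg (p ^ 2)) m
    rwa [← Real.exp_nat_mul, mul_neg] at this
  have h3 := Real.quadratic_le_exp_of_nonneg (x := m * p ^ 2) (by positivity)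
  calc _ ≤ Real.exp (-(m * p ^ 2)) * Real.exp (m * p ^ 2) :=
        mul_le_mul h2 h3 (by positivity) (Real.exp_pos _).le
    _ = 1 := by rw [← Real.exp_add]; simp

theorem pow_one_sub_two_mul_sq_add_le {p : ℝ} (h0 : 0 ≤ p) (h1 : p ≤ 1 / 2) (m : ℕ)
    (hm : 2 * (m * p ^ 3) ≤ 1) :
    (1 - 2 * p ^ 2 + p ^ 3) ^ m ≤ ((1 - p ^ 2) ^ m) ^ 2 * (1 + 4 * (m * p ^ 3)) := by
  have hp2 : p ^ 2 ≤ 1 / 4 := by nlinarith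
  have hb : 1 - 2 * p ^ 2 + p ^ 3 ≤ (1 - p ^ 2) ^ 2 * (1 + 2 * p ^ 3) := by
    have : 0 ≤ p ^ 3 * (1 - 4 * p ^ 2) + p ^ 4 + 2 * p ^ 7 := by
      have := mul_nonneg (pow_nonneg h0 3) (show 0 ≤ 1 - 4 * p ^ 2 by linarith)
      positivity
    linarith [show (1 - p ^ 2) ^ 2 * (1 + 2 * p ^ 3) =
      1 - 2 * p ^ 2 + p ^ 3 + (p ^ 3 * (1 - 4 * p ^ 2) + p ^ 4 + 2 * p ^ 7) by ring]
  have h2 : (1 + 2 * p ^ 3) ^ m ≤ 1 + 4 * (m * p ^ 3) := by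
    have h3 := pow_le_pow_left₀ (by positivity) (Real.add_one_le_exp (2 * p ^ 3)) m
    rw [← Real.exp_nat_mul] at h3
    have h4 := Real.abs_exp_sub_one_le (x := m * (2 * p ^ 3))
      (by rw [abs_of_nonneg (by positivity)]; linarith)
    rw [abs_of_nonneg (a := m * (2 * p ^ 3)) (by positivity)] at h4
    have h5 := (abs_le.1 h4).2
    rw [add_comm (2 * p ^ 3) 1] at h3
    linarith
  have ha : 0 ≤ 1 - 2 * p ^ 2 + p ^ 3 := by
    have := pow_nonneg h0 3
    linarith
  calc _ ≤ ((1 - p ^ 2) ^ 2 * (1 + 2 * p ^ 3)) ^ m := pow_le_pow_left₀ ha hb m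
    _ = ((1 - p ^ 2) ^ m) ^ 2 * (1 + 2 * p ^ 3) ^ m := by rw [mul_pow, pow_right_comm]
    _ ≤ _ := mul_le_mul_of_nonneg_left h2 (sq_nonneg _)

/-- Solving the self-bounding inequality for the second moment `R`. Here `r ^ 2` is the number of
elements and `l ^ 2` is its product with `p ^ 2`. -/
theorem mul_sub_le_of_self_bound {p r l w a R n Λ : ℝ} (hr : 0 < r) (hl : 0 < l) (hpl : p * r = l)
    (hn : 0 ≤ n) (hΛ1 : 1 ≤ Λ) (hΛ : Λ ^ 4 = n) (hlΛ : l ^ 2 ≤ Λ) (hw0 : 0 < w) (hw1 : w < 1)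
    (hw : w * (1 + l ^ 2 + (l ^ 2) ^ 2 / 2) ≤ 1) (ha : a ≤ w ^ 2 * (1 + 4 * (p * l ^ 2)))
    (hp4 : p * l ^ 2 ≤ 1 / 4)
    (hR : R ≤ a + p * l ^ 2 * R + p ^ 2 * w * (n * l ^ 2 + n) + 2 * p ^ 2 * a * (n ^ 2 * l ^ 2) +
      2 * p ^ 3 * w * (n ^ 3 * (l ^ 2) ^ 2)) :
    n ^ 2 * (R - w ^ 2) ≤ (10 * (n ^ 2 / r) + 24 * (n ^ 2 / r) ^ 2 + 16 * (n ^ 2 / r) ^ 3) *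
      (w * (1 - w)) := by
  have hv : 0 < 1 - w := by linarith
  obtain rfl : p = l / r := by field_simp; exact hpl
  have hp0 : 0 < l / r := by positivity
  have hE1 : l ^ 3 * w ≤ 1 - w := by
    have : l ^ 3 * w ≤ (l ^ 2 + (l ^ 2) ^ 2 / 2) * w :=
      mul_le_mul_of_nonneg_right (by nlinarith [sq_nonneg (l * (l - 1))]) hw0.le
    linarith
  have hE2 : l ^ 2 ≤ (1 + l ^ 2) * (1 - w) := by
    have : 0 ≤ w * (l ^ 2) ^ 2 / 2 := by positivity
    linarith
  have hE3 : (l ^ 2) ^ 2 * w ≤ 2 * (1 - w) := by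
    have : 0 ≤ w * l ^ 2 := by positivity
    linarith
  have ha2 : a ≤ 2 * w ^ 2 := by nlinarith [sq_nonneg w]
  have hΛn : Λ ^ 2 ≤ n := by rw [← hΛ]; exact pow_le_pow_right₀ hΛ1 (by norm_num)
  have hl1 : 1 + l ^ 2 ≤ 2 * Λ := by linarith
  have hlin : R - w ^ 2 ≤ 2 * (5 * (l / r * l ^ 2) * w ^ 2 + (l / r) ^ 2 * w * (n * l ^ 2 + n) +
      4 * (l / r) ^ 2 * w ^ 2 * (n ^ 2 * l ^ 2) + 2 * (l / r) ^ 3 * w * (n ^ 3 * (l ^ 2) ^ 2)) := by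
    have h1 : 2 * (l / r) ^ 2 * a * (n ^ 2 * l ^ 2) ≤
        2 * (l / r) ^ 2 * (2 * w ^ 2) * (n ^ 2 * l ^ 2) := by gcongr
    have h2 : (R - w ^ 2) * (1 - l / r * l ^ 2) ≤ 5 * (l / r * l ^ 2) * w ^ 2 +
        (l / r) ^ 2 * w * (n * l ^ 2 + n) + 4 * (l / r) ^ 2 * w ^ 2 * (n ^ 2 * l ^ 2) +
        2 * (l / r) ^ 3 * w * (n ^ 3 * (l ^ 2) ^ 2) := by linarith
    have h3 : 0 ≤ 5 * (l / r * l ^ 2) * w ^ 2 + (l / r) ^ 2 * w * (n * l ^ 2 + n) +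
        4 * (l / r) ^ 2 * w ^ 2 * (n ^ 2 * l ^ 2) +
        2 * (l / r) ^ 3 * w * (n ^ 3 * (l ^ 2) ^ 2) := by positivity
    rcases le_total (R - w ^ 2) 0 with h | h
    · linarith
    · nlinarith
  have hT1 : l / r * l ^ 2 * w ≤ (1 - w) / r := by
    rw [show l / r * l ^ 2 * w = l ^ 3 * w / r by ring]
    gcongr
  have hT2 : (l / r) ^ 2 * (n * l ^ 2 + n) ≤ 4 * n ^ 2 / r ^ 2 * (1 - w) := by
    rw [show (l / r) ^ 2 * (n * l ^ 2 + n) = n * (l ^ 2 * (1 + l ^ 2)) / r ^ 2 by ring,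
      show 4 * n ^ 2 / r ^ 2 * (1 - w) = n * (4 * n * (1 - w)) / r ^ 2 by ring]
    refine div_le_div_of_nonneg_right (mul_le_mul_of_nonneg_left ?_ hn) (by positivity)
    calc l ^ 2 * (1 + l ^ 2) ≤ (1 + l ^ 2) * (1 - w) * (1 + l ^ 2) := by gcongr
      _ = (1 + l ^ 2) ^ 2 * (1 - w) := by ring
      _ ≤ (2 * Λ) ^ 2 * (1 - w) := by gcongr
      _ = 4 * Λ ^ 2 * (1 - w) := by ring
      _ ≤ 4 * n * (1 - w) := by gcongr
  have hT3 : (l / r) ^ 2 * w * l ^ 2 ≤ 2 * (1 - w) / r ^ 2 := by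
    rw [show (l / r) ^ 2 * w * l ^ 2 = (l ^ 2) ^ 2 * w / r ^ 2 by ring]
    gcongr
  have hT4 : (l / r) ^ 3 * (l ^ 2) ^ 2 ≤ 4 * n / r ^ 3 * (1 - w) := by
    rw [show (l / r) ^ 3 * (l ^ 2) ^ 2 = l * (l ^ 2) ^ 2 * l ^ 2 / r ^ 3 by ring,
      show 4 * n / r ^ 3 * (1 - w) = 4 * n * (1 - w) / r ^ 3 by ring]
    refine div_le_div_of_nonneg_right ?_ (by positivity)
    calc l * (l ^ 2) ^ 2 * l ^ 2 ≤ (1 + l ^ 2) * Λ ^ 2 * ((1 + l ^ 2) * (1 - w)) := by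
          gcongr
          nlinarith [sq_nonneg (l - 1)]
      _ = (1 + l ^ 2) ^ 2 * Λ ^ 2 * (1 - w) := by ring
      _ ≤ (2 * Λ) ^ 2 * Λ ^ 2 * (1 - w) := by gcongr
      _ = 4 * n * (1 - w) := by rw [← hΛ]; ring
  calc n ^ 2 * (R - w ^ 2) ≤ n ^ 2 * (2 * (5 * (l / r * l ^ 2) * w ^ 2 +
        (l / r) ^ 2 * w * (n * l ^ 2 + n) + 4 * (l / r) ^ 2 * w ^ 2 * (n ^ 2 * l ^ 2) +
        2 * (l / r) ^ 3 * w * (n ^ 3 * (l ^ 2) ^ 2))) := by gcongr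
    _ = (10 * n ^ 2 * (l / r * l ^ 2 * w) + 2 * n ^ 2 * ((l / r) ^ 2 * (n * l ^ 2 + n)) +
        8 * n ^ 4 * ((l / r) ^ 2 * w * l ^ 2) + 4 * n ^ 5 * ((l / r) ^ 3 * (l ^ 2) ^ 2)) * w := by
      ring
    _ ≤ (10 * n ^ 2 * ((1 - w) / r) + 2 * n ^ 2 * (4 * n ^ 2 / r ^ 2 * (1 - w)) +
        8 * n ^ 4 * (2 * (1 - w) / r ^ 2) + 4 * n ^ 5 * (4 * n / r ^ 3 * (1 - w))) * w := by
      gcongr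
    _ = _ := by ring

/-- The bound in the regime in which the expected number of common elements of two sets is at most
`n ^ (1 / 4)`. -/
theorem tvDist_le_sqrt {n m : ℕ} (p : I) (hp : 0 < (p : ℝ)) (hn : 4 ≤ n) (hm : n ^ 4 ≤ m) {Λ : ℝ}
    (hΛ1 : 1 ≤ Λ) (hΛ : Λ ^ 4 = n) (hlΛ : m * (p : ℝ) ^ 2 ≤ Λ) :
    tvDist (randomIntersectionGraph n m p)
      (SimpleGraph.binomialRandom (Fin n) (edgeProb m p)) ≤
    √(10 * ((n : ℝ) ^ 2 / √m) + 24 * ((n : ℝ) ^ 2 / √m) ^ 2 + 16 * ((n : ℝ) ^ 2 / √m) ^ 3) := by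
  have hn' : (4 : ℝ) ≤ n := by exact_mod_cast hn
  have hm' : (n : ℝ) ^ 4 ≤ m := by exact_mod_cast hm
  have hm0 : (0 : ℝ) < m := lt_of_lt_of_le (by positivity) hm'
  set P : ℝ := (p : ℝ) with hP
  set r : ℝ := √m with hr
  have hr2 : r ^ 2 = m := Real.sq_sqrt hm0.le
  have hr0 : 0 < r := Real.sqrt_pos.2 hm0
  have hnr : (n : ℝ) ^ 2 ≤ r := Real.le_sqrt_of_sq_le (by rw [← pow_mul]; exact hm')
  have hl0 : 0 < P * r := by positivity
  have hl2 : (P * r) ^ 2 = m * P ^ 2 := by rw [mul_pow, hr2, mul_comm]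
  have hlΛ2 : (P * r) ^ 2 ≤ Λ := hl2 ▸ hlΛ
  have hlΛ1 : P * r ≤ Λ := by nlinarith
  have hΛ2 : Λ ^ 2 ≤ n := by rw [← hΛ]; exact pow_le_pow_right₀ hΛ1 (by norm_num)
  have hΛn : Λ ≤ n := by nlinarith
  have hPn : P * n ^ 2 ≤ Λ := (mul_le_mul_of_nonneg_left hnr hp.le).trans hlΛ1
  have hP4 : P ≤ 1 / 4 := by
    have : P * n ≤ 1 := by
      refine le_of_mul_le_mul_right (a := (n : ℝ)) ?_ (by linarith)
      linarith [show P * n * n = P * n ^ 2 by ring]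
    nlinarith
  have hPl : P * (P * r) ^ 2 ≤ 1 / 4 := by
    have h1 : P * n ^ 2 * (P * r) ^ 2 ≤ Λ * Λ :=
      mul_le_mul hPn hlΛ2 (sq_nonneg _) (by linarith)
    have h2 : P * (P * r) ^ 2 * n ≤ 1 := by
      refine le_of_mul_le_mul_right (a := (n : ℝ)) ?_ (by linarith)
      linarith [show P * (P * r) ^ 2 * n * n = P * n ^ 2 * (P * r) ^ 2 by ring]
    have h3 : 0 ≤ P * (P * r) ^ 2 := by positivity
    nlinarith
  set w : ℝ := (1 - P ^ 2) ^ m with hw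
  have hP2 : 0 < P ^ 2 := by positivity
  have hP21 : P ^ 2 < 1 := by nlinarith
  have hw0 : 0 < w := pow_pos (by linarith) m
  have hw1 : w < 1 := pow_lt_one₀ (by linarith) (by linarith) (by rintro rfl; simp at hm0)
  have hwl := pow_one_sub_sq_mul_le hp.le (by linarith) m
  have ha := pow_one_sub_two_mul_sq_add_le hp.le (by linarith) m
    (by linarith [show P * (m * P ^ 2) = m * P ^ 3 by ring, hl2 ▸ hPl])
  rw [show (m : ℝ) * P ^ 3 = P * (m * P ^ 2) by ring] at ha
  rw [← hl2] at hwl ha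
  set s : ℝ := (n : ℝ) ^ 2 / r with hs
  have hn0 : (0 : ℝ) < (n : ℝ) ^ 2 := by positivity
  have hε : ∀ k i : Fin n, k ≠ i → pairMoment {j : Fin n // j ≠ k ∧ j ≠ i} (Fin m) P ≤
      w ^ 2 + (10 * s + 24 * s ^ 2 + 16 * s ^ 3) / n ^ 2 * (w * (1 - w)) := by
    intro k i _
    have hJ : (Fintype.card {j : Fin n // j ≠ k ∧ j ≠ i} : ℝ) ≤ n := by
      exact_mod_cast (Fintype.card_subtype_le _).trans_eq (Fintype.card_fin n)
    have hR := pairMoment_le (J := {j : Fin n // j ≠ k ∧ j ≠ i}) (M := Fin m) hp (by linarith)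
      (by rw [Fintype.card_fin, ← hl2]; linarith) hJ
    rw [Fintype.card_fin, ← hl2] at hR
    have := mul_sub_le_of_self_bound hr0 hl0 rfl (Nat.cast_nonneg n) hΛ1 hΛ hlΛ2 hw0 hw1 hwl ha
      hPl hR
    rw [← sub_le_iff_le_add', div_mul_eq_mul_div, le_div_iff₀ hn0]
    linarith
  have hmain := sum_abs_cellMass_intersectionGraph_sub_le (V := Fin n) (M := Fin m) hp.le
    (by linarith) _ w (by rw [Fintype.card_fin]) hw0 hw1 hε
  rw [Fintype.card_fin] at hmain
  rw [tvDist_eq_sum_cellMass]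
  refine (mul_le_mul_of_nonneg_left hmain (by norm_num)).trans ?_
  rw [← mul_assoc, one_div, inv_mul_cancel₀ two_ne_zero, one_mul]
  refine Real.sqrt_le_sqrt ?_
  have hc : (n.choose 2 : ℝ) ≤ n ^ 2 := by exact_mod_cast Nat.choose_le_pow n 2
  have hs0 : 0 ≤ s := by positivity
  calc _ ≤ (n : ℝ) ^ 2 * ((10 * s + 24 * s ^ 2 + 16 * s ^ 3) / n ^ 2) := by gcongr
    _ = _ := by field_simp

theorem tvDist_le_exp (n m : ℕ) (p : I) {Λ : ℝ} (hΛ : Λ ^ 4 = n) (hlΛ : Λ ≤ m * (p : ℝ) ^ 2) :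
    tvDist (randomIntersectionGraph n m p)
      (SimpleGraph.binomialRandom (Fin n) (edgeProb m p)) ≤ 2 * (Λ ^ 8 * Real.exp (-Λ)) := by
  have h2 : (1 - (p : ℝ) ^ 2) ^ m ≤ Real.exp (-(m * (p : ℝ) ^ 2)) := by
    have := pow_le_pow_left₀ (by nlinarith [p.2.1, p.2.2]) (Real.one_sub_le_exp_neg ((p : ℝ) ^ 2)) m
    rwa [← Real.exp_nat_mul, mul_neg] at this
  have h3 : Real.exp (-(m * (p : ℝ) ^ 2)) ≤ Real.exp (-Λ) := Real.exp_le_exp.2 (by linarith)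
  have hc : (n.choose 2 : ℝ) ≤ Λ ^ 8 := by
    rw [show Λ ^ 8 = (Λ ^ 4) ^ 2 by ring, hΛ]
    exact_mod_cast Nat.choose_le_pow n 2
  refine (tvDist_le_choose_mul n m p).trans ?_
  have h4 := h2.trans h3
  have h5 : 0 ≤ (1 - (p : ℝ) ^ 2) ^ m := pow_nonneg (by nlinarith [p.2.1, p.2.2]) m
  gcongr

end Analysis

theorem tvDist_nonneg {α : Type*} [Fintype α] [MeasurableSpace α] (μ ν : Measure α) :
    0 ≤ tvDist μ ν :=
  mul_nonneg (by norm_num) (Finset.sum_nonneg fun _ _ => abs_nonneg _)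

theorem theorem2 (m : ℕ → ℕ) (p : ℕ → unitInterval)
    (hm : Tendsto (fun n : ℕ => (m n : ℝ) / (n : ℝ) ^ 4) atTop atTop) :
    Tendsto (fun n : ℕ => tvDist (randomIntersectionGraph n (m n) (p n))
      (SimpleGraph.binomialRandom (Fin n) (edgeProb (m n) (p n)))) atTop (𝓝 0) := by
  set Λ : ℕ → ℝ := fun n => (n : ℝ) ^ (1 / 4 : ℝ) with hΛdef
  have hΛ : ∀ n, Λ n ^ 4 = n := fun n => by
    rw [hΛdef, ← Real.rpow_natCast, ← Real.rpow_mul (Nat.cast_nonneg n)]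
    norm_num
  have hΛlim : Tendsto Λ atTop atTop :=
    (tendsto_rpow_atTop (by norm_num)).comp tendsto_natCast_atTop_atTop
  set s : ℕ → ℝ := fun n => (n : ℝ) ^ 2 / √(m n) with hsdef
  have hs : Tendsto s atTop (𝓝 0) := by
    have h1 : Tendsto (fun n : ℕ => (√((m n : ℝ) / (n : ℝ) ^ 4))⁻¹) atTop (𝓝 0) :=
      tendsto_inv_atTop_zero.comp (Real.tendsto_sqrt_atTop.comp hm)
    refine h1.congr fun n => ?_
    rw [Real.sqrt_div (Nat.cast_nonneg _), inv_div, show (n : ℝ) ^ 4 = ((n : ℝ) ^ 2) ^ 2 by ring,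
      Real.sqrt_sq (by positivity)]
  have hbound : Tendsto (fun n => √(10 * s n + 24 * s n ^ 2 + 16 * s n ^ 3) +
      2 * (Λ n ^ 8 * Real.exp (-Λ n))) atTop (𝓝 0) := by
    have h1 : Tendsto (fun n => √(10 * s n + 24 * s n ^ 2 + 16 * s n ^ 3)) atTop (𝓝 0) := by
      have := (((hs.const_mul 10).add ((hs.pow 2).const_mul 24)).add
        ((hs.pow 3).const_mul 16)).sqrt
      simpa using this
    have h2 := ((Real.tendsto_pow_mul_exp_neg_atTop_nhds_zero 8).comp hΛlim).const_mul 2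
    simpa using h1.add h2
  refine squeeze_zero' (Eventually.of_forall fun n => tvDist_nonneg _ _) ?_ hbound
  filter_upwards [eventually_ge_atTop 4, hm.eventually_ge_atTop 1, hΛlim.eventually_ge_atTop 1]
    with n hn hmn hΛ1
  have hn0 : (0 : ℝ) < (n : ℝ) ^ 4 := by positivity
  have hmn' : n ^ 4 ≤ m n := by
    rw [le_div_iff₀ hn0, one_mul] at hmn
    exact_mod_cast hmn
  have hexp : 0 ≤ 2 * (Λ n ^ 8 * Real.exp (-Λ n)) := by positivity
  rcases eq_or_ne (p n) 0 with hp | hp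
  · rw [hp, tvDist_eq_zero_of_eq_zero]
    positivity
  · have hp0 : 0 < (p n : ℝ) := lt_of_le_of_ne (p n).2.1 fun h => hp (Subtype.ext h.symm)
    rcases le_total (m n * (p n : ℝ) ^ 2) (Λ n) with h | h
    · exact (tvDist_le_sqrt (p n) hp0 hn hmn' hΛ1 (hΛ n) h).trans (le_add_of_nonneg_right hexp)
    · exact (tvDist_le_exp n (m n) (p n) (hΛ n) h).trans
        (le_add_of_nonneg_left (Real.sqrt_nonneg _))
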